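/- **Model.** Let $d\ge 1$ be the rank, $\eta>0$, $m>0$ (mass), $\Lambda>0$ (cutoff). For $\vec p\in\mathbb Z^d$ put $\vec p^{\,2\eta}:=\sum_{j}|p_j|^{2\eta}$, and consider the tensor field theory with propagator $$C(\vec p)=\frac{\Theta(\Lambda^{2\eta}-\vec p^{\,2\eta})}{\vec p^{\,2\eta}+m^{2\eta}},\qquad \Theta(x)=1\ (x\ge 0),\quad \Theta(x)=0\ (x<0),$$ and quartic melonic interaction $$\lambda\sum_{i=1}^d\sum_{\vec p_1,\dots,\vec p_4}\delta_{p_{1i}p_{4i}}\delta_{p_{2i}p_{3i}}\prod_{j\ne i}\delta_{p_{1j}p_{2j}}\delta_{p_{3j}p_{4j}}\;T_{\vec p_1}\bar T_{\vec p_2}T_{\vec p_3}\bar T_{\vec p_4}.$$ All correlation functions are formal power series in $\lambda$, given by their Feynman expansion $\sum_n\frac{(-\lambda)^n}{n!}\sum\mathcal A$ over the colourings of $n$ vertices and the Wick contractions, $\mathcal A$ being the amputated Feynman amplitude. **Melonic graphs.** In the intermediate field representation of a vacuum graph, the nodes are the cycles of propagator lines ($T_{\vec p_1},\bar T_{\vec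 p_2}$, and $T_{\vec p_3},\bar T_{\vec p_4}$, being the two corners of a vertex), and every vertex is an edge between the cycles through its two corners. A vacuum graph is *melonic* if this multigraph is a tree. A graph with $2N$ external legs is melonic, with heart external faces of colour $i$, if it is obtained by cutting $N$ propagator lines of a melonic vacuum graph that all lie on one common face of colour $i$. **Functions.** Let $\Sigma(\vec p)$ be the sum over the one-particle irreducible (1PI) melonic two-point graphs, $\Gamma^{(2)}(\vec p)=\vec p^{\,2\eta}+m^{2\eta}-\Sigma(\vec p)$, and, for a colour $i$, $$\mathcal L:=\sum_{\vec q\in\mathbb Z^d,\ \vec q^{\,2\eta}\le\Lambda^{2\eta}}\delta_{q_i0}\,[\Gamma^{(2)}(\vec q)]^{-2}.$$ Let $\gamma^{(4)}:=\Gamma^{(4),i}_{\vec 0,\vec 0,\vec 0,\vec 0}$ be the zero-momenta value of the colour-$i$ component of the 1PI melonic four-point function, i.e. minus the sum of the amputated amplitudes at zero external momenta of the 1PI melonic four-point graphs whose heart external faces have colour $i$. **Corollary.** For every colour $i$, $$\gamma^{(4)}=\frac{4\lambda}{1+2\lambda\,\mathcal L}$$ as an identity of formal power series in $\lambda$ with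 real coefficients. -/

import Mathlib

open scoped Classical

noncomputable section

namespace Melonic

/-! ### The model -/

/-- Momenta `p ∈ ℤ^d`. -/
abbrev Momentum (d : ℕ) : Type := Fin d → ℤ

/-- `p^{2η} := ∑ᵢ |pᵢ|^{2η}`. -/
def momentumPow {d : ℕ} (η : ℝ) (p : Momentum d) : ℝ :=
  ∑ i, |(p i : ℝ)| ^ (2 * η)

/-- The kinetic kernel `p^{2η} + m^{2η}`. -/
def kinetic {d : ℕ} (η m : ℝ) (p : Momentum d) : ℝ :=
  momentumPow η p + m ^ (2 * η)

/-- The Heaviside step function, with the value `1` at the origin. -/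
def heaviside (x : ℝ) : ℝ := if 0 ≤ x then 1 else 0

/-- The bare propagator `Θ(Λ^{2η} - p^{2η}) / (p^{2η} + m^{2η})`. -/
def propagator {d : ℕ} (η m Λ : ℝ) (p : Momentum d) : ℝ :=
  heaviside (Λ ^ (2 * η) - momentumPow η p) / kinetic η m p

/-! ### Feynman graphs as Wick contractions

`V` is the set of (labelled) quartic vertices. The fields `T_{p₁} T̄_{p₂} T_{p₃} T̄_{p₄}` of a vertex
`v` are grouped in two corners: `(v, false)` carries `T_{p₁}, T̄_{p₂}` and `(v, true)` carries
`T_{p₃}, T̄_{p₄}`. There are `N` external fields `T_k` and `N` external fields `T̄_k`. -/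

/-- An index set for the fields `T`, and at the same time for the fields `T̄`:
`Sum.inl (v, b)` is the field at the corner `b` of the vertex `v`, and `Sum.inr k` is the `k`-th
external field. -/
abbrev Leg (V : Type) (N : ℕ) : Type := (V × Bool) ⊕ Fin N

/-- A Wick contraction: the field `T` of index `x` is contracted with the field `T̄` of index `σ x`.
The propagator line (edge of colour `0`) so obtained is also named `x`. -/
abbrev Wick (V : Type) (N : ℕ) : Type := Equiv.Perm (Leg V N)

/-- The vertex tensor of colour `c v` identifies the momentum component of colour `j` of the field
`T̄` at a corner of `v` with that of the field `T` at the opposite corner of `v` if `j = c v`, and at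
the same corner if `j ≠ c v`. -/
def partner {V : Type} {d : ℕ} (c : V → Fin d) (j : Fin d) : Equiv.Perm (V × Bool) where
  toFun y := if c y.1 = j then (y.1, !y.2) else y
  invFun y := if c y.1 = j then (y.1, !y.2) else y
  left_inv y := by by_cases h : c y.1 = j <;> simp [h]
  right_inv y := by by_cases h : c y.1 = j <;> simp [h]

/-- The momenta `P x` of the lines `x` obey all the Kronecker deltas of the vertices, and the
external fields `T̄_k`, `T_k` have the momenta `r k`, `s k`. -/
def Compatible {V : Type} {d N : ℕ} (c : V → Fin d) (σ : Wick V N)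
    (r s : Fin N → Momentum d) (P : Leg V N → Momentum d) : Prop :=
  (∀ k, P (σ.symm (Sum.inr k)) = r k) ∧ (∀ k, P (Sum.inr k) = s k) ∧
    ∀ (y : V × Bool) (j : Fin d),
      P (σ.symm (Sum.inl y)) j = P (Sum.inl (partner c j y)) j

/-- The line `x` joins two vertices, i.e. it is not hooked to an external field. -/
def IsInternal {V : Type} {N : ℕ} (σ : Wick V N) (x : Leg V N) : Prop :=
  x.isLeft = true ∧ (σ x).isLeft = true

/-- The amputated Feynman amplitude: the sum over the momenta allowed by the vertices of the product
of the propagators of the internal lines. -/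
def amplitude {V : Type} [Fintype V] {d N : ℕ} (η m Λ : ℝ) (c : V → Fin d) (σ : Wick V N)
    (r s : Fin N → Momentum d) : ℝ :=
  ∑ᶠ P ∈ {P : Leg V N → Momentum d | Compatible c σ r s P},
    ∏ x with IsInternal σ x, propagator η m Λ (P x)

/-- The graph on the vertices `V` given by the internal lines other than the lines in `D`. -/
def lineGraph {V : Type} {N : ℕ} (σ : Wick V N) (D : Set (Leg V N)) : SimpleGraph V :=
  SimpleGraph.fromRel fun v w =>
    ∃ b b', (Sum.inl (v, b) : Leg V N) ∉ D ∧ σ (Sum.inl (v, b)) = Sum.inl (w, b')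

/-- One-particle irreducibility: connected, and still connected after the deletion of any one
line. -/
def IsOnePI {V : Type} {N : ℕ} (σ : Wick V N) : Prop :=
  (lineGraph σ ∅).Connected ∧
    ∀ x : Leg V N, IsInternal σ x → (lineGraph σ {x}).Connected

/-! ### Melonic graphs -/

/-- The loop-vertices of a vacuum graph `τ`: the cycles of propagator lines (two consecutive lines
of such a cycle meet at a corner of a vertex). -/
abbrev LoopVertex {V : Type} (τ : Equiv.Perm (V × Bool)) : Type :=
  Quotient (Equiv.Perm.SameCycle.setoid τ)

/-- The loop-vertex through the corner `y`. -/
def loopVertex {V : Type} (τ : Equiv.Perm (V × Bool)) (y : V × Bool) : LoopVertex τ :=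
  Quotient.mk (Equiv.Perm.SameCycle.setoid τ) y

/-- The intermediate field representation of a vacuum graph: its nodes are the loop-vertices, and
every vertex `v` of the graph is an edge, between the loop-vertices through its two corners. -/
def intermediateGraph {V : Type} (τ : Equiv.Perm (V × Bool)) : SimpleGraph (LoopVertex τ) :=
  SimpleGraph.fromRel fun a b => ∃ v, a = loopVertex τ (v, false) ∧ b = loopVertex τ (v, true)

/-- A vacuum graph is melonic if its intermediate field representation, a multigraph with edge set
`V`, is a tree: it is connected and has one node more than it has edges. -/
def IsMelonicVacuum {V : Type} [Fintype V] (τ : Equiv.Perm (V × Bool)) : Prop :=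
  (intermediateGraph τ).Connected ∧ Nat.card (LoopVertex τ) = Fintype.card V + 1

/-- The faces of colour `j` of a vacuum graph are the cycles of this permutation of its lines:
follow the line `x` up to its field `T̄`, then the colour `j` through the vertex. -/
def facePerm {V : Type} {d : ℕ} (c : V → Fin d) (τ : Equiv.Perm (V × Bool)) (j : Fin d) :
    Equiv.Perm (V × Bool) :=
  partner c j * τ

/-- The graph `σ` is obtained from the vacuum graph `τ` by cutting the `N` distinct lines `ℓ k`.
The field `T` of the cut line `ℓ k` is hooked to the external `T̄_k`, and its field `T̄` to the
external `T_{π k}`, for some labelling `π`. -/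
def IsCut {V : Type} {N : ℕ} (τ : Equiv.Perm (V × Bool)) (ℓ : Fin N ↪ V × Bool) (σ : Wick V N) :
    Prop :=
  ∃ π : Equiv.Perm (Fin N),
    (∀ x, (∀ k, x ≠ ℓ k) → σ (Sum.inl x) = Sum.inl (τ x)) ∧
    ∀ k, σ (Sum.inl (ℓ k)) = Sum.inr k ∧ σ (Sum.inr (π k)) = Sum.inl (τ (ℓ k))

/-- The graph `σ` with `2N` external fields is melonic with heart external faces of colour `i`: it is
obtained by cutting `N` lines of a melonic vacuum graph that run all along one face of colour `i`. -/
def IsMelonic {V : Type} [Fintype V] {d N : ℕ} (i : Fin d) (c : V → Fin d) (σ : Wick V N) : Prop :=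
  ∃ (τ : Equiv.Perm (V × Bool)) (ℓ : Fin N ↪ V × Bool),
    IsMelonicVacuum τ ∧ IsCut τ ℓ σ ∧
      ∀ k l, (facePerm c τ i).SameCycle (ℓ k) (ℓ l)

/-! ### Correlation functions, as formal power series in the coupling `λ = PowerSeries.X` -/

/-- The perturbative expansion `∑ₙ (-λ)ⁿ / n! ∑ 𝒜`, where the inner sum runs over the colourings of
`n` vertices and the Wick contractions that are one-particle irreducible and obey `R`. -/
def onePISeries {d N : ℕ} (η m Λ : ℝ) (R : (n : ℕ) → (Fin n → Fin d) → Wick (Fin n) N → Prop)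
    (r s : Fin N → Momentum d) : PowerSeries ℝ :=
  PowerSeries.mk fun n =>
    (-1) ^ n / (n.factorial : ℝ) *
      ∑ c : Fin n → Fin d, ∑ σ : Wick (Fin n) N,
        if IsOnePI σ ∧ R n c σ then amplitude η m Λ c σ r s else 0

/-- The melonic self-energy `Σ(p)`. -/
def selfEnergy {d : ℕ} (η m Λ : ℝ) (p : Momentum d) : PowerSeries ℝ :=
  onePISeries (N := 1) η m Λ (fun _ c σ => ∃ i, IsMelonic i c σ) (fun _ => p) (fun _ => p)

/-- The melonic two-point function `Γ⁽²⁾(p) = p^{2η} + m^{2η} - Σ(p)`. -/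
def Gamma2 {d : ℕ} (η m Λ : ℝ) (p : Momentum d) : PowerSeries ℝ :=
  PowerSeries.C (kinetic η m p) - selfEnergy η m Λ p

/-- The component of colour `i` of the 1PI melonic four-point function, with momenta `r 0, r 1` of
the fields `T̄` and `s 0, s 1` of the fields `T`. By the convention
`⟨T̄TT̄T⟩ = -Γ⁽⁴⁾ G G G G + …` it is minus the sum of the amputated amplitudes. -/
def Gamma4 {d : ℕ} (η m Λ : ℝ) (i : Fin d) (r s : Fin 2 → Momentum d) : PowerSeries ℝ :=
  -onePISeries (N := 2) η m Λ (fun _ c σ => IsMelonic i c σ) r s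

/-- The zero-momenta melonic four-point function `γ⁽⁴⁾`. -/
def gamma4 {d : ℕ} (η m Λ : ℝ) (i : Fin d) : PowerSeries ℝ :=
  Gamma4 η m Λ i (fun _ => 0) (fun _ => 0)

/-- The loop `𝓛 = ∑_q δ_{q_i 0} Γ⁽²⁾(q)⁻²`, summed over the momenta below the cutoff. -/
def loopL {d : ℕ} (η m Λ : ℝ) (i : Fin d) : PowerSeries ℝ :=
  ∑ᶠ q ∈ {q : Momentum d | q i = 0 ∧ momentumPow η q ≤ Λ ^ (2 * η)}, ((Gamma2 η m Λ q)⁻¹) ^ 2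

end Melonic

end

/-! Every vertex of a melonic vacuum graph is a bridge of its intermediate field representation
(`isMelonicVacuum_iff`). If a cut line shares its loop-vertex with another line, the cut graph is
therefore disconnected after removing at most one further line. So the 1PI melonic graphs are
exactly those whose cut lines are leaves, that is, fixed points of the contraction `τ`
(`IsCut.isOnePI_iff`).

Seen from the corner opposite to a leaf, `τ` is a plane binary tree of corners: the root line leads
to a corner, a subtree hangs from the opposite corner of that vertex, and the rest of the
loop-vertex follows. The encoding is bijective (`exists_treePerm_eq`, `treePerm_injective`).
Conservation along separating sets makes the momentum constant on each loop-vertex and preserves the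
component of colour `c v` across `v` (`vacuum_conservation_iff`), so amplitudes factor along the
tree (`IsCut.amplitude_eq`). The `n! 2^n` labellings of a shape contribute equally after summing
over colourings (`sum_leafTrees`). They cancel `1/n!` and give each vertex the weight `-2λ`.

What remains are generating functions of coloured binary trees, decomposed at the root. Let `C` be
the propagator, `G` the connected two-point function (`fullSeries`), `Σ` the self-energy, `H` the
connected function with a further leaf of momentum `p = 0` cut on the colour-`i` face of the root
(`markedSeries`), and `Φ` its 1PI counterpart (`ladderSeries`). Then `G = C (1 + Σ G)` and `H = C (Φ
G + Σ H)`, so below the cutoff `G = 1/Γ⁽²⁾` and `H = G² Φ`. Moreover `Φ(q) = -2λ ∑_{k_i = q_i} (H(k)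
+ δ_{k,0})`, which depends on `q` only through `q_i`. At `q_i = 0` the ladder equation thus becomes
scalar, `Φ = -2λ (𝓛 Φ + 1)`. The two ways of labelling the external fields `T` give `γ⁽⁴⁾ = -2Φ`. -/

noncomputable section

namespace Melonic

section

/-! ### Rooted plane trees of vertices, and the permutations they encode -/

variable {V : Type}

/-- The other corner of the same vertex. -/
def opp (y : V × Bool) : V × Bool := (y.1, !y.2)

@[simp] theorem opp_fst (y : V × Bool) : (opp y).1 = y.1 := rfl

@[simp] theorem opp_opp (y : V × Bool) : opp (opp y) = y := by simp [opp]

theorem opp_ne (y : V × Bool) : opp y ≠ y := by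
  rcases y with ⟨v, b⟩; cases b <;> simp [opp]

theorem eq_or_eq_opp {x y : V × Bool} (h : x.1 = y.1) : x = y ∨ x = opp y := by
  rcases x with ⟨v, b⟩; rcases y with ⟨w, b'⟩
  cases b <;> cases b' <;> simp_all [opp]

/-- The vertices occurring in a tree of corners, in prefix order. -/
def labels : BinaryTree (V × Bool) → List V
  | .nil => []
  | .node y a b => y.1 :: (labels a ++ labels b)

/-- The lines of a tree rooted at the line `r`. -/
def InDom (t : BinaryTree (V × Bool)) (r x : V × Bool) : Prop := x = r ∨ x.1 ∈ labels t

/-- The permutation encoded by a tree with root `r`: in `node y a b` the root is followed by the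
corner `y`, the subtree `a` hangs from the opposite corner, and `b` follows `y`. -/
def treePerm : BinaryTree (V × Bool) → V × Bool → Equiv.Perm (V × Bool)
  | .nil, _ => 1
  | .node y a b, r => treePerm a (opp y) * treePerm b r * Equiv.swap r y

/-- The tree `t` with root `r` has pairwise distinct vertices, none of them that of the root. -/
def Proper (t : BinaryTree (V × Bool)) (r : V × Bool) : Prop :=
  (labels t).Nodup ∧ r.1 ∉ labels t

theorem Proper.node_iff {y r : V × Bool} {a b : BinaryTree (V × Bool)} :
    Proper (.node y a b) r ↔ Proper a (opp y) ∧ Proper b r ∧ r.1 ≠ y.1 ∧ r.1 ∉ labels a ∧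
      y.1 ∉ labels b ∧ List.Disjoint (labels a) (labels b) := by
  simp only [Proper, labels, List.nodup_cons, List.nodup_append', List.mem_cons, List.mem_append,
    opp_fst]
  tauto

theorem mem_iff_of_fixes_compl {α : Type*} {ρ : Equiv.Perm α} {D : α → Prop}
    (h : ∀ x, ¬ D x → ρ x = x) (x : α) : D (ρ x) ↔ D x := by
  constructor
  · intro hx
    by_contra hc
    rw [h x hc] at hx
    exact hc hx
  · intro hx
    by_contra hc
    have := ρ.injective (h _ hc)
    rw [this] at hc
    exact hc hx

theorem treePerm_of_not_inDom (t : BinaryTree (V × Bool)) (r x : V × Bool) (h : ¬ InDom t r x) :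
    treePerm t r x = x := by
  induction t generalizing r with
  | nil => rfl
  | node y a b iha ihb =>
    simp only [InDom, labels, List.mem_cons, List.mem_append, not_or] at h
    have h1 : x ≠ y := fun e => h.2.1 (by rw [e])
    simp only [treePerm, Equiv.Perm.mul_apply]
    rw [Equiv.swap_apply_of_ne_of_ne h.1 h1, ihb r, iha]
    · simp only [InDom, not_or]
      exact ⟨fun e => h.2.1 (by rw [e]; rfl), h.2.2.1⟩
    · simp only [InDom, not_or]
      exact ⟨h.1, h.2.2.2⟩

theorem inDom_treePerm (t : BinaryTree (V × Bool)) (r x : V × Bool) :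
    InDom t r (treePerm t r x) ↔ InDom t r x :=
  mem_iff_of_fixes_compl (treePerm_of_not_inDom t r) x

theorem inDom_node {y r x : V × Bool} {a b : BinaryTree (V × Bool)} :
    InDom (.node y a b) r x ↔ x = y ∨ InDom a (opp y) x ∨ InDom b r x := by
  simp only [InDom, labels, List.mem_cons, List.mem_append]
  constructor
  · rintro (h | h | h | h)
    · tauto
    · rcases eq_or_eq_opp h <;> tauto
    · tauto
    · tauto
  · rintro (h | (h | h) | (h | h)) <;> simp [h]

section NodePerm

variable {y r : V × Bool} {a b : BinaryTree (V × Bool)} (h : Proper (.node y a b) r)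
include h

theorem Proper.ne_root : y ≠ r := by
  rw [Proper.node_iff] at h
  rintro rfl
  exact h.2.2.1 rfl

theorem Proper.not_inDom_left_self : ¬ InDom a (opp y) y := by
  rw [Proper.node_iff] at h
  rintro (h1 | h1)
  · exact opp_ne y h1.symm
  · exact h.1.2 h1

theorem Proper.not_inDom_right_self : ¬ InDom b r y := by
  have := h.ne_root
  rw [Proper.node_iff] at h
  rintro (h1 | h1)
  · exact this h1
  · exact h.2.2.2.2.1 h1

theorem Proper.disjoint_inDom {x : V × Bool} (h1 : InDom a (opp y) x) : ¬ InDom b r x := by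
  rw [Proper.node_iff] at h
  rintro (h2 | h2)
  · subst h2
    rcases h1 with h1 | h1
    · rw [h1] at h; exact h.2.2.1 rfl
    · exact h.2.2.2.1 h1
  · rcases h1 with h1 | h1
    · rw [h1] at h2; exact h.2.2.2.2.1 h2
    · exact h.2.2.2.2.2 h1 h2

theorem treePerm_node_root : treePerm (.node y a b) r r = y := by
  simp only [treePerm, Equiv.Perm.mul_apply, Equiv.swap_apply_left]
  rw [treePerm_of_not_inDom b r y h.not_inDom_right_self,
    treePerm_of_not_inDom a _ y h.not_inDom_left_self]

theorem treePerm_node_self : treePerm (.node y a b) r y = treePerm b r r := by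
  simp only [treePerm, Equiv.Perm.mul_apply, Equiv.swap_apply_right]
  refine treePerm_of_not_inDom a _ _ fun h1 => h.disjoint_inDom h1 ?_
  rw [inDom_treePerm]
  exact Or.inl rfl

theorem treePerm_node_left {x : V × Bool} (hx : InDom a (opp y) x) :
    treePerm (.node y a b) r x = treePerm a (opp y) x := by
  have h1 : x ≠ y := by rintro rfl; exact h.not_inDom_left_self hx
  have h2 : x ≠ r := by rintro rfl; exact h.disjoint_inDom hx (Or.inl rfl)
  simp only [treePerm, Equiv.Perm.mul_apply, Equiv.swap_apply_of_ne_of_ne h2 h1]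
  rw [treePerm_of_not_inDom b r x (h.disjoint_inDom hx)]

theorem treePerm_node_right {x : V × Bool} (hx : InDom b r x) (hr : x ≠ r) :
    treePerm (.node y a b) r x = treePerm b r x := by
  have h1 : x ≠ y := by rintro rfl; exact h.not_inDom_right_self hx
  simp only [treePerm, Equiv.Perm.mul_apply, Equiv.swap_apply_of_ne_of_ne hr h1]
  refine treePerm_of_not_inDom a _ _ fun h2 => h.disjoint_inDom h2 ?_
  rwa [inDom_treePerm]

end NodePerm

theorem treePerm_root_eq_iff {t : BinaryTree (V × Bool)} {r : V × Bool} (h : Proper t r) :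
    treePerm t r r = r ↔ t = .nil := by
  cases t with
  | nil => simp [treePerm]
  | node y a b => simp [treePerm_node_root h, h.ne_root]

/-- A permutation which is a tree on the vertices `A`, rooted at the line `r`. -/
structure IsRootedTree (A : Finset V) (r : V × Bool) (ρ : Equiv.Perm (V × Bool)) : Prop where
  supp : ∀ x, x ≠ r → x.1 ∉ A → ρ x = x
  conn : ∀ S : Set (V × Bool), r ∈ S → (∀ x, ρ x ∈ S ↔ x ∈ S) →
    (∀ x, x.1 ∈ A → x ∈ S → opp x ∈ S) → ∀ x, x.1 ∈ A → x ∈ S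
  sep : ∀ v ∈ A, ∃ S : Set (V × Bool), (∀ x, ρ x ∈ S ↔ x ∈ S) ∧
    (∀ x, x.1 ∈ A → x.1 ≠ v → x ∈ S → opp x ∈ S) ∧ (v, false) ∈ S ∧ (v, true) ∉ S

end

/-! ### Tree permutations: intrinsic characterisation and uniqueness of the tree. -/

section

variable {V : Type}

theorem IsRootedTree.sep_corner {A : Finset V} {r : V × Bool} {ρ : Equiv.Perm (V × Bool)}
    (h : IsRootedTree A r ρ) {y : V × Bool} (hy : y.1 ∈ A) :
    ∃ S : Set (V × Bool), (∀ x, ρ x ∈ S ↔ x ∈ S) ∧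
      (∀ x, x.1 ∈ A → x.1 ≠ y.1 → x ∈ S → opp x ∈ S) ∧ y ∈ S ∧ opp y ∉ S := by
  obtain ⟨S, h1, h2, h3, h4⟩ := h.sep _ hy
  rcases y with ⟨v, b⟩
  cases b
  · exact ⟨S, h1, h2, h3, h4⟩
  · refine ⟨Sᶜ, fun x => not_congr (h1 x), fun x hx hv hxS hc => hxS ?_, h4, fun hc => hc h3⟩
    simpa using h2 (opp x) hx hv hc

theorem isRootedTree_nil {r : V × Bool} : IsRootedTree ∅ r 1 := by
  constructor <;> simp

/-- Connectedness spreads from `r` through `y` to `opp y`, then into both subtrees. Separating sets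
are built by extending those of the subtrees by constants. -/
theorem isRootedTree_treePerm {t : BinaryTree (V × Bool)} {r : V × Bool} (h : Proper t r) :
    IsRootedTree (labels t).toFinset r (treePerm t r) := by
  induction t generalizing r with
  | nil => exact isRootedTree_nil
  | node y a b iha ihb =>
    have hp := Proper.node_iff.1 h
    have ia := iha hp.1
    have ib := ihb hp.2.1
    have hd : ∀ x, InDom a (opp y) x → InDom b r x → False := fun x => h.disjoint_inDom
    have hya := h.not_inDom_left_self
    have hyb := h.not_inDom_right_self
    have hyr := h.ne_root
    have e0 := treePerm_node_root h
    have e1 := treePerm_node_self h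
    have e2 : ∀ x, InDom a (opp y) x → _ := fun x => treePerm_node_left h
    have e3 : ∀ x, InDom b r x → x ≠ r → _ := fun x => treePerm_node_right h
    have fa := treePerm_of_not_inDom a (opp y)
    have fb := treePerm_of_not_inDom b r
    have ma := inDom_treePerm a (opp y)
    have mb := inDom_treePerm b r
    have e4 : ∀ x, ¬ (x = y ∨ InDom a (opp y) x ∨ InDom b r x) →
        treePerm (.node y a b) r x = x := fun x hx =>
      treePerm_of_not_inDom _ _ _ (by rwa [inDom_node])
    have cA : ∀ x : V × Bool, x.1 ∈ (labels (.node y a b)).toFinset ↔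
        x.1 = y.1 ∨ x.1 ∈ labels a ∨ x.1 ∈ labels b := by
      intro x; simp [labels]
    have oa : ∀ x, x.1 ∈ labels a → InDom a (opp y) x := fun x => Or.inr
    have ob : ∀ x, x.1 ∈ labels b → InDom b r x := fun x => Or.inr
    have ra : InDom a (opp y) (opp y) := Or.inl rfl
    have rb : InDom b r r := Or.inl rfl
    have cv : ∀ x : V × Bool, x.1 = y.1 → x = y ∨ x = opp y := fun x => eq_or_eq_opp
    set ρ := treePerm (.node y a b) r with hρ
    constructor
    · intro x hx hxA
      rw [cA] at hxA
      apply e4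
      rintro (rfl | (rfl | h1) | (rfl | h1)) <;> simp_all
    · intro S hr hS ho
      have hyS : y ∈ S := by rw [← e0, hS]; exact hr
      have hB : ∀ x, x.1 ∈ labels b → x ∈ S := by
        have := ib.conn S hr ?_ (fun x hx => ho x ((cA x).2 (by simp at hx; tauto)))
        · simpa using this
        · intro x
          by_cases hx : InDom b r x
          · by_cases hxr : x = r
            · subst hxr; rw [← e1, hS]; tauto
            · rw [← e3 x hx hxr, hS]
          · rw [fb x hx]
      have hyS' : opp y ∈ S := ho y ((cA y).2 (Or.inl rfl)) hyS
      have hA : ∀ x, x.1 ∈ labels a → x ∈ S := by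
        have := ia.conn S hyS' ?_ (fun x hx => ho x ((cA x).2 (by simp at hx; tauto)))
        · simpa using this
        · intro x
          by_cases hx : InDom a (opp y) x
          · rw [← e2 x hx, hS]
          · rw [fa x hx]
      intro x hx
      rcases (cA x).1 hx with hx | hx | hx
      · rcases cv x hx with rfl | rfl <;> assumption
      · exact hA x hx
      · exact hB x hx
    · have key : ∀ z : V × Bool, z.1 ∈ (labels (.node y a b)).toFinset →
          ∃ S : Set (V × Bool), (∀ x, ρ x ∈ S ↔ x ∈ S) ∧
          (∀ x, x.1 ∈ (labels (.node y a b)).toFinset → x.1 ≠ z.1 → x ∈ S → opp x ∈ S) ∧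
          ((z ∈ S ∧ opp z ∉ S) ∨ (z ∉ S ∧ opp z ∈ S)) := by
        intro z hz
        rcases (cA z).1 hz with hz | hz | hz
        · have ho : ∀ x : V × Bool, x.1 ≠ y.1 → InDom a (opp y) x → InDom a (opp y) (opp x) := by
            rintro x hx (rfl | hxa)
            · exact absurd rfl hx
            · exact Or.inr hxa
          -- The vertex of `y` is separated by the left branch, which is attached to the rest only
          -- through this vertex.
          refine ⟨{x | InDom a (opp y) x}, ?_, ?_, ?_⟩
          · intro x
            simp only [Set.mem_ofPred_eq]
            by_cases hx : InDom a (opp y) x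
            · rw [e2 x hx, ma]
            · have : ∀ z, InDom a (opp y) (ρ z) → InDom a (opp y) z := by
                intro z hz
                by_contra hc
                by_cases h1 : z = y
                · subst h1; rw [e1] at hz; exact hd _ hz ((mb _).2 rb)
                · by_cases h2 : z = r
                  · subst h2; rw [e0] at hz; exact hya hz
                  · by_cases h3 : InDom b r z
                    · rw [e3 z h3 h2] at hz; exact hd _ hz ((mb _).2 h3)
                    · rw [e4 z (by tauto)] at hz; exact hc hz
              exact ⟨this x, fun h => absurd h hx⟩
          · intro x _ hx hxS
            exact ho x (by rwa [hz] at hx) hxS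
          · rcases cv z hz with rfl | rfl
            · exact Or.inr ⟨hya, ra⟩
            · exact Or.inl ⟨ra, by simpa using hya⟩
        · obtain ⟨S, s1, s2, s3, s4⟩ := ia.sep_corner (y := z) (by simpa using hz)
          -- Everything outside the left branch is put on the side of `opp y`, the point where the
          -- branch is attached.
          refine ⟨{x | if InDom a (opp y) x then x ∈ S else opp y ∈ S}, ?_, ?_, ?_⟩
          · intro x
            have hρa : InDom a (opp y) (ρ x) ↔ InDom a (opp y) x := by
              by_cases hx : InDom a (opp y) x
              · rw [e2 x hx, ma]
              · have : ¬ InDom a (opp y) (ρ x) := by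
                  intro hz
                  by_cases h1 : x = y
                  · subst h1; rw [e1] at hz; exact hd _ hz ((mb _).2 rb)
                  · by_cases h2 : x = r
                    · subst h2; rw [e0] at hz; exact hya hz
                    · by_cases h3 : InDom b r x
                      · rw [e3 x h3 h2] at hz; exact hd _ hz ((mb _).2 h3)
                      · rw [e4 x (by tauto)] at hz; exact hx hz
                tauto
            simp only [Set.mem_ofPred_eq]
            by_cases hx : InDom a (opp y) x
            · rw [if_pos hx, if_pos (hρa.2 hx), e2 x hx, s1]
            · rw [if_neg hx, if_neg (mt hρa.1 hx)]
          · intro x hxA hx hxS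
            simp only [Set.mem_ofPred_eq] at hxS ⊢
            by_cases hxy : x.1 = y.1
            · rcases cv x hxy with rfl | rfl
              · rw [if_neg hya] at hxS; rwa [if_pos ra]
              · rw [if_pos ra] at hxS
                rwa [if_neg (by simpa using hya)]
            · by_cases hxa : x.1 ∈ labels a
              · rw [if_pos (oa x hxa)] at hxS
                rw [if_pos (oa (opp x) hxa)]
                exact s2 x (by simpa using hxa) hx hxS
              · have n1 : ¬ InDom a (opp y) x := by
                  rintro (rfl | h1)
                  · exact hxy rfl
                  · exact hxa h1
                have n2 : ¬ InDom a (opp y) (opp x) := by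
                  rintro (h1 | h1)
                  · exact hxy (by simpa using congrArg Prod.fst h1)
                  · exact hxa h1
                rw [if_neg n1] at hxS
                rwa [if_neg n2]
          · left
            simp only [Set.mem_ofPred_eq]
            rw [if_pos (oa z hz), if_pos (oa (opp z) hz)]
            exact ⟨s3, s4⟩
        · obtain ⟨S, s1, s2, s3, s4⟩ := ib.sep_corner (y := z) (by simpa using hz)
          -- Likewise, everything outside the right subtree is put on the side of its root `r`.
          refine ⟨{x | if InDom b r x then x ∈ S else r ∈ S}, ?_, ?_, ?_⟩
          · intro x
            simp only [Set.mem_ofPred_eq]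
            by_cases h1 : x = y
            · subst h1
              rw [e1, if_pos ((mb _).2 rb), if_neg hyb, s1]
            · by_cases h2 : x = r
              · rw [h2, e0, if_neg hyb, if_pos rb]
              · by_cases h3 : InDom b r x
                · rw [e3 x h3 h2, if_pos ((mb _).2 h3), if_pos h3, s1]
                · by_cases h4 : InDom a (opp y) x
                  · rw [e2 x h4, if_neg (hd _ ((ma _).2 h4)), if_neg h3]
                  · rw [e4 x (by tauto)]
          · intro x hxA hx hxS
            simp only [Set.mem_ofPred_eq] at hxS ⊢
            by_cases hxb : x.1 ∈ labels b
            · rw [if_pos (ob x hxb)] at hxS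
              rw [if_pos (ob (opp x) hxb)]
              exact s2 x (by simpa using hxb) hx hxS
            · have hxr : x.1 ≠ r.1 := by
                rintro e
                rcases (cA x).1 hxA with h1 | h1 | h1
                · exact hp.2.2.1 (e.symm.trans h1)
                · rw [e] at h1; exact hp.2.2.2.1 h1
                · exact hxb h1
              have n1 : ¬ InDom b r x := by
                rintro (rfl | h1)
                · exact hxr rfl
                · exact hxb h1
              have n2 : ¬ InDom b r (opp x) := by
                rintro (h1 | h1)
                · exact hxr (by simpa using congrArg Prod.fst h1)
                · exact hxb h1
              rw [if_neg n1] at hxS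
              rwa [if_neg n2]
          · left
            simp only [Set.mem_ofPred_eq]
            rw [if_pos (ob z hz), if_pos (ob (opp z) hz)]
            exact ⟨s3, s4⟩
      intro v hv
      obtain ⟨S, s1, s2, (s3 | s3)⟩ := key (v, false) hv
      · exact ⟨S, s1, s2, s3⟩
      · refine ⟨Sᶜ, fun x => not_congr (s1 x), fun x hx hv hxS hc => hxS ?_, s3.1,
          fun hc => hc s3.2⟩
        simpa using s2 (opp x) hx hv hc

/-- Restriction of a permutation to an invariant set, extended by the identity. -/
def restrictPerm {α : Type*} (ρ : Equiv.Perm α) (S : Set α) (h : ∀ x, ρ x ∈ S ↔ x ∈ S) :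
    Equiv.Perm α where
  toFun x := if x ∈ S then ρ x else x
  invFun x := if x ∈ S then ρ.symm x else x
  left_inv x := by by_cases hx : x ∈ S <;> simp [hx, h]
  right_inv x := by
    have : ρ.symm x ∈ S ↔ x ∈ S := by rw [← h (ρ.symm x)]; simp
    by_cases hx : x ∈ S <;> simp [hx, this]

theorem restrictPerm_apply {α : Type*} (ρ : Equiv.Perm α) (S : Set α) (h : ∀ x, ρ x ∈ S ↔ x ∈ S)
    (x : α) : restrictPerm ρ S h x = if x ∈ S then ρ x else x := rfl

/-- Induction on the number of vertices: a set separating the corner `y = ρ r` from `opp y` splits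
the permutation, once `y` is taken off its cycle, into the branch hanging from `opp y` and the
remainder rooted at `r`. -/
theorem exists_treePerm_eq (n : ℕ) (A : Finset V) (hn : A.card = n) (r : V × Bool) (hr : r.1 ∉ A)
    (ρ : Equiv.Perm (V × Bool)) (h : IsRootedTree A r ρ) :
    ∃ t, Proper t r ∧ (labels t).toFinset = A ∧ treePerm t r = ρ := by
  induction n using Nat.strong_induction_on generalizing A r ρ with
  | _ n ih =>
  by_cases h0 : ρ r = r
  · have hA : A = ∅ := by
      rw [Finset.eq_empty_iff_forall_notMem]
      intro v hv
      -- A fixed root forms a closed set by itself, so connectedness leaves no vertex in `A`.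
      have := h.conn {r} rfl (fun x => by
        simp only [Set.mem_singleton_iff]
        constructor
        · intro hx; exact ρ.injective (hx.trans h0.symm)
        · rintro rfl; exact h0) (fun x hx hxr => by rw [hxr] at hx; exact absurd hx hr) (v, true) hv
      rw [Set.mem_singleton_iff] at this
      rw [← this] at hr
      exact hr hv
    subst hA
    refine ⟨.nil, ⟨by simp [labels], by simp [labels]⟩, by simp [labels], ?_⟩
    ext1 x
    by_cases hx : x = r
    · rw [hx, h0]; rfl
    · rw [h.supp x hx (by simp)]; rfl
  · set y := ρ r with hy
    have hyA : y.1 ∈ A := by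
      by_contra hc
      have := h.supp y h0 hc
      exact h0 (ρ.injective this)
    obtain ⟨S, s1, s2, s3, s4⟩ := h.sep_corner hyA
    have hrS : r ∈ S := by rw [← s1]; exact s3
    have hry : r.1 ≠ y.1 := fun e => hr (by rwa [e])
    have sopp : ∀ x : V × Bool, x.1 ∈ A → x.1 ≠ y.1 → (opp x ∈ S ↔ x ∈ S) := fun x hx hxy =>
      ⟨fun hh => by simpa using s2 (opp x) hx hxy hh, s2 x hx hxy⟩
    -- This removes `y` from the cycle of the root: `r` now goes to `ρ y`, and `y` is fixed. It
    -- undoes the factor `swap r y` in `treePerm`.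
    set ρ' := ρ * Equiv.swap r y with hρ'
    have p1 : ρ' r = ρ y := by simp [hρ']
    have p2 : ρ' y = y := by simp [hρ', hy]
    have p3 : ∀ x, x ≠ r → x ≠ y → ρ' x = ρ x := fun x h1 h2 => by
      simp [hρ', Equiv.swap_apply_of_ne_of_ne h1 h2]
    have i1 : ∀ x, ρ' x ∈ Sᶜ ↔ x ∈ Sᶜ := by
      intro x
      simp only [Set.mem_compl_iff, not_iff_not]
      by_cases h1 : x = r
      · rw [h1, p1, s1]; tauto
      · by_cases h2 : x = y
        · rw [h2, p2]
        · rw [p3 x h1 h2, s1]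
    have i2 : ∀ x, ρ' x ∈ S ↔ x ∈ S := fun x => by simpa using not_congr (i1 x)
    set ρ1 := restrictPerm ρ' Sᶜ i1 with hρ1
    set ρ2 := restrictPerm ρ' S i2 with hρ2
    have q1 : ∀ x, x ∉ S → ρ1 x = ρ x := fun x hx => by
      rw [hρ1, restrictPerm_apply, if_pos (show x ∈ Sᶜ from hx), p3]
      · rintro rfl; exact hx hrS
      · rintro rfl; exact hx s3
    have q1' : ∀ x, x ∈ S → ρ1 x = x := fun x hx => by
      rw [hρ1, restrictPerm_apply, if_neg (by simpa using hx)]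
    have q2 : ∀ x, x ∈ S → ρ2 x = ρ' x := fun x hx => by
      rw [hρ2, restrictPerm_apply, if_pos hx]
    have q2' : ∀ x, x ∉ S → ρ2 x = x := fun x hx => by
      rw [hρ2, restrictPerm_apply, if_neg hx]
    have hmul : ρ1 * ρ2 * Equiv.swap r y = ρ := by
      have : ρ1 * ρ2 = ρ' := by
        ext1 x
        rw [Equiv.Perm.mul_apply]
        by_cases hx : x ∈ S
        · rw [q2 x hx, q1' _ ((i2 x).2 hx)]
        · rw [q2' x hx, q1 x hx, p3]
          · rintro rfl; exact hx hrS
          · rintro rfl; exact hx s3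
      rw [this, hρ', mul_assoc]; simp
    -- Testing one corner suffices: apart from the vertex of `y`, `S` contains both corners of a
    -- vertex of `A` or neither.
    set A1 := A.filter fun v => v ≠ y.1 ∧ (v, true) ∉ S with hA1
    set A2 := A.filter fun v => v ≠ y.1 ∧ (v, true) ∈ S with hA2
    have mS : ∀ x : V × Bool, x.1 ∈ A → x.1 ≠ y.1 → ((x.1, true) ∈ S ↔ x ∈ S) := by
      rintro ⟨v, b⟩ hx hxy
      cases b
      · exact sopp (v, false) hx hxy
      · rfl
    have m1 : ∀ x : V × Bool, x.1 ∈ A1 ↔ x.1 ∈ A ∧ x.1 ≠ y.1 ∧ x ∉ S := by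
      intro x
      rw [hA1, Finset.mem_filter]
      constructor
      · rintro ⟨ha, hb, hc⟩; exact ⟨ha, hb, by rwa [← mS x ha hb]⟩
      · rintro ⟨ha, hb, hc⟩; exact ⟨ha, hb, by rwa [mS x ha hb]⟩
    have m2 : ∀ x : V × Bool, x.1 ∈ A2 ↔ x.1 ∈ A ∧ x.1 ≠ y.1 ∧ x ∈ S := by
      intro x
      rw [hA2, Finset.mem_filter]
      constructor
      · rintro ⟨ha, hb, hc⟩; exact ⟨ha, hb, by rwa [← mS x ha hb]⟩
      · rintro ⟨ha, hb, hc⟩; exact ⟨ha, hb, by rwa [mS x ha hb]⟩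
    have c1 : A1.card < n := by
      rw [← hn]
      refine Finset.card_lt_card (Finset.ssubset_iff_of_subset (Finset.filter_subset _ _) |>.2
        ⟨y.1, hyA, fun hc => ((m1 y).1 hc).2.1 rfl⟩)
    have c2 : A2.card < n := by
      rw [← hn]
      refine Finset.card_lt_card (Finset.ssubset_iff_of_subset (Finset.filter_subset _ _) |>.2
        ⟨y.1, hyA, fun hc => ((m2 y).1 hc).2.1 rfl⟩)
    have t1 : IsRootedTree A1 (opp y) ρ1 := by
      constructor
      · intro x hx hxA
        by_cases hxS : x ∈ S
        · exact q1' x hxS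
        · rw [q1 x hxS]
          refine h.supp x (by rintro rfl; exact hxS hrS) fun hc => ?_
          by_cases hxy : x.1 = y.1
          · rcases eq_or_eq_opp hxy with rfl | rfl
            · exact hxS s3
            · exact hx rfl
          · exact hxA ((m1 x).2 ⟨hc, hxy, hxS⟩)
      · intro T hT hi ho x hx
        have hx' := (m1 x).1 hx
        have := h.conn (S ∪ T) (Or.inl hrS) (fun z => ?_) (fun z hz hzT => ?_) x hx'.1
        · rcases this with h1 | h1
          · exact absurd h1 hx'.2.2
          · exact h1
        · simp only [Set.mem_union, s1]
          by_cases hz : z ∈ S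
          · simp [hz]
          · rw [← hi z, q1 z hz]
        · by_cases hzy : z.1 = y.1
          · rcases eq_or_eq_opp hzy with rfl | rfl
            · exact Or.inr hT
            · exact Or.inl (by simpa using s3)
          · by_cases hzS : z ∈ S
            · exact Or.inl ((sopp z hz hzy).2 hzS)
            · exact Or.inr (ho z ((m1 z).2 ⟨hz, hzy, hzS⟩) (hzT.resolve_left hzS))
      · intro v hv
        have hv' := (m1 (v, true)).1 hv
        have hv'' := (m1 (v, false)).1 hv
        obtain ⟨T, u1, u2, u3, u4⟩ := h.sep v hv'.1
        refine ⟨T \ S, fun x => ?_, fun x hx hxv hxT => ?_, ⟨u3, hv''.2.2⟩, fun hc => u4 hc.1⟩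
        · by_cases hxS : x ∈ S
          · rw [q1' x hxS]
          · rw [q1 x hxS]; simp [u1, s1]
        · have := (m1 x).1 hx
          exact ⟨u2 x this.1 hxv hxT.1, by rw [sopp x this.1 this.2.1]; exact hxT.2⟩
    have t2 : IsRootedTree A2 r ρ2 := by
      constructor
      · intro x hx hxA
        by_cases hxS : x ∈ S
        · rw [q2 x hxS]
          by_cases hxy : x = y
          · rw [hxy, p2]
          · rw [p3 x hx hxy]
            refine h.supp x hx fun hc => ?_
            by_cases hxy' : x.1 = y.1
            · rcases eq_or_eq_opp hxy' with rfl | rfl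
              · exact hxy rfl
              · exact s4 hxS
            · exact hxA ((m2 x).2 ⟨hc, hxy', hxS⟩)
        · exact q2' x hxS
      · intro T hT hi ho x hx
        have hx' := (m2 x).1 hx
        have hρy : ρ y ∈ T := by rw [← p1, ← q2 r hrS, hi]; exact hT
        -- `T` need not contain `y`, which `ρ2` fixes, but `ρ` passes through `y` right after the
        -- root, so `y` has to be added.
        have := h.conn (Sᶜ ∪ T ∪ {y}) (Or.inl (Or.inr hT)) (fun z => ?_) (fun z hz hzT => ?_) x hx'.1
        · rcases this with (h1 | h1) | h1
          · exact absurd hx'.2.2 h1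
          · exact h1
          · exact absurd (congrArg Prod.fst h1) hx'.2.1
        · by_cases hz : z ∈ S
          · by_cases hzr : z = r
            · subst hzr
              simp [← hy, hT]
            · by_cases hzy : z = y
              · subst hzy
                simp [hρy]
              · have h3 : ρ z ∈ T ↔ z ∈ T := by rw [← hi z, q2 z hz, p3 z hzr hzy]
                have h4 : ρ z ≠ y := fun e => hzr (ρ.injective e)
                simp [s1, h3, hzy, h4]
          · simp [s1, hz]
        · by_cases hzy : z.1 = y.1
          · rcases eq_or_eq_opp hzy with rfl | rfl
            · exact Or.inl (Or.inl s4)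
            · exact Or.inr (by simp)
          · by_cases hzS : z ∈ S
            · refine Or.inl (Or.inr (ho z ((m2 z).2 ⟨hz, hzy, hzS⟩) ?_))
              rcases hzT with (h1 | h1) | h1
              · exact absurd hzS h1
              · exact h1
              · exact absurd (congrArg Prod.fst h1) hzy
            · exact Or.inl (Or.inl (mt (sopp z hz hzy).1 hzS))
      · intro v hv
        have hv' := (m2 (v, true)).1 hv
        have hv'' := (m2 (v, false)).1 hv
        obtain ⟨T, u1, u2, u3, u4⟩ := h.sep v hv'.1
        have hrT : y ∈ T ↔ r ∈ T := by rw [hy, u1]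
        refine ⟨T ∩ S, fun x => ?_, fun x hx hxv hxT => ?_, ⟨u3, hv''.2.2⟩, fun hc => u4 hc.1⟩
        · by_cases hxS : x ∈ S
          · rw [q2 x hxS]
            by_cases hxr : x = r
            · rw [hxr, p1]; simp [u1, s1, hrT, s3, hrS]
            · by_cases hxy : x = y
              · rw [hxy, p2]
              · rw [p3 x hxr hxy]; simp [u1, s1]
          · rw [q2' x hxS]
        · have := (m2 x).1 hx
          exact ⟨u2 x this.1 hxv hxT.1, by rw [sopp x this.1 this.2.1]; exact hxT.2⟩
    have hy1 : (opp y).1 ∉ A1 := fun hc => ((m1 (opp y)).1 hc).2.1 rfl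
    have hr2 : r.1 ∉ A2 := fun hc => hr ((m2 r).1 hc).1
    obtain ⟨a, a1, a2, a3⟩ := ih _ c1 A1 rfl (opp y) hy1 ρ1 t1
    obtain ⟨b, b1, b2, b3⟩ := ih _ c2 A2 rfl r hr2 ρ2 t2
    have la : ∀ v, v ∈ labels a ↔ v ∈ A1 := fun v => by rw [← a2]; simp
    have lb : ∀ v, v ∈ labels b ↔ v ∈ A2 := fun v => by rw [← b2]; simp
    refine ⟨.node y a b, ?_, ?_, ?_⟩
    · rw [Proper.node_iff]
      refine ⟨a1, b1, hry, ?_, ?_, ?_⟩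
      · rw [la]; exact fun hc => hr ((m1 r).1 hc).1
      · rw [lb]; exact fun hc => ((m2 y).1 hc).2.1 rfl
      · intro v hva hvb
        rw [la] at hva; rw [lb] at hvb
        exact ((m1 (v, true)).1 hva).2.2 ((m2 (v, true)).1 hvb).2.2
    · ext v
      simp only [labels, List.toFinset_cons, List.toFinset_append, a2, b2, Finset.mem_insert,
        Finset.mem_union]
      constructor
      · rintro (rfl | h1 | h1)
        · exact hyA
        · exact ((m1 (v, true)).1 h1).1
        · exact ((m2 (v, true)).1 h1).1
      · intro hv
        by_cases hvy : v = y.1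
        · exact Or.inl hvy
        · by_cases hvS : (v, true) ∈ S
          · exact Or.inr (Or.inr ((m2 (v, true)).2 ⟨hv, hvy, hvS⟩))
          · exact Or.inr (Or.inl ((m1 (v, true)).2 ⟨hv, hvy, hvS⟩))
    · rw [treePerm, a3, b3, hmul]

theorem inDom_of_closed {t : BinaryTree (V × Bool)} {r : V × Bool} (h : Proper t r)
    {S : Set (V × Bool)} (hr : r ∈ S) (hS : ∀ x, treePerm t r x ∈ S ↔ x ∈ S)
    (ho : ∀ x, x.1 ∈ labels t → x ∈ S → opp x ∈ S) {x : V × Bool} (hx : InDom t r x) : x ∈ S := by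
  rcases hx with rfl | hx
  · exact hr
  · exact (isRootedTree_treePerm h).conn S hr hS (by simpa using ho) x (by simpa using hx)

/-- The tree is read off from the permutation: the first corner is the image of the root, and the
lines of the left subtree form the smallest set containing `opp y` that is closed under its
permutation and under passing to the opposite corner of its vertices. -/
theorem treePerm_injective {t t' : BinaryTree (V × Bool)} {r : V × Bool} (h : Proper t r)
    (h' : Proper t' r) (hl : ∀ v, v ∈ labels t ↔ v ∈ labels t')
    (he : treePerm t r = treePerm t' r) : t = t' := by
  induction t generalizing r t' with
  | nil => exact ((treePerm_root_eq_iff h').1 (by rw [← he, treePerm_root_eq_iff h])).symm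
  | node y a b iha ihb =>
    cases t' with
    | nil => simpa [labels] using hl y.1
    | node z a' b' =>
      have hyz : y = z := by rw [← treePerm_node_root h, he, treePerm_node_root h']
      subst hyz
      have hp := Proper.node_iff.1 h
      have hp' := Proper.node_iff.1 h'
      -- Stated for general subtrees so that it yields both inclusions between the two left domains.
      have key : ∀ (a b a' b' : BinaryTree (V × Bool)) (_ : Proper (.node y a b) r)
          (_ : Proper (.node y a' b') r)
          (_ : ∀ v, v ∈ labels (.node y a b) → v ∈ labels (.node y a' b'))
          (_ : treePerm (.node y a b) r = treePerm (.node y a' b') r), ∀ x,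
          InDom a (opp y) x → InDom a' (opp y) x := by
        intro a b a' b' h h' hl he x hx
        have hp := Proper.node_iff.1 h
        refine inDom_of_closed hp.1 (S := {x | InDom a' (opp y) x}) (Or.inl rfl) ?_ ?_ hx
        · have : ∀ x, InDom a' (opp y) x → InDom a' (opp y) (treePerm a (opp y) x) := by
            intro x hx
            by_cases hxa : InDom a (opp y) x
            · rw [← treePerm_node_left h hxa, he, treePerm_node_left h' hx, inDom_treePerm]
              exact hx
            · rwa [treePerm_of_not_inDom a _ x hxa]
          intro x
          refine ⟨fun hx => ?_, this x⟩
          by_cases hxa : InDom a (opp y) x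
          · have h1 := treePerm_node_left h hxa
            rw [he] at h1
            rw [← h1] at hx
            by_contra hc
            have hnot : ∀ z, ¬ InDom a' (opp y) z → ¬ InDom a' (opp y) (treePerm (.node y a' b') r z) := by
              intro z hz hz'
              obtain ⟨w, hw⟩ := (treePerm a' (opp y)).surjective (treePerm (.node y a' b') r z)
              have hwd : InDom a' (opp y) w := by rw [← inDom_treePerm, hw]; exact hz'
              rw [← treePerm_node_left h' hwd] at hw
              rw [(treePerm (.node y a' b') r).injective hw] at hwd
              exact hz hwd
            exact hnot x hc hx
          · simp only [Set.mem_ofPred_eq] at hx ⊢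
            rwa [treePerm_of_not_inDom a _ x hxa] at hx
        · rintro x hxa (rfl | hx)
          · exact absurd hxa hp.1.2
          · exact Or.inr hx
      have hA : ∀ x, InDom a (opp y) x ↔ InDom a' (opp y) x := fun x =>
        ⟨key a b a' b' h h' (fun v => (hl v).1) he x,
          key a' b' a b h' h (fun v => (hl v).2) he.symm x⟩
      have hla : ∀ v, v ∈ labels a ↔ v ∈ labels a' := by
        intro v
        by_cases hv : v = y.1
        · rw [hv]; exact iff_of_false hp.1.2 hp'.1.2
        · have := hA (v, true)
          have h1 : (v, true) ≠ opp y := fun e => hv (congrArg Prod.fst e)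
          simpa [InDom, h1] using this
      have hpa : treePerm a (opp y) = treePerm a' (opp y) := by
        ext1 x
        by_cases hx : InDom a (opp y) x
        · rw [← treePerm_node_left h hx, he, treePerm_node_left h' ((hA x).1 hx)]
        · rw [treePerm_of_not_inDom a _ x hx, treePerm_of_not_inDom a' _ x (mt (hA x).2 hx)]
      have hpb : treePerm b r = treePerm b' r := by
        simp only [treePerm, hpa] at he
        exact mul_left_cancel (mul_right_cancel he)
      have hlb : ∀ v, v ∈ labels b ↔ v ∈ labels b' := by
        intro v
        have := hl v
        simp only [labels, List.mem_cons, List.mem_append] at this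
        have e1 := hla v
        have e2 : v ∈ labels b → v ∉ labels a := fun x y => hp.2.2.2.2.2 y x
        have e3 : v ∈ labels b' → v ∉ labels a' := fun x y => hp'.2.2.2.2.2 y x
        have e4 : v ∈ labels b → v ≠ y.1 := fun x e => hp.2.2.2.2.1 (by rwa [← e])
        have e5 : v ∈ labels b' → v ≠ y.1 := fun x e => hp'.2.2.2.2.1 (by rwa [← e])
        tauto
      rw [iha hp.1 hp'.1 hla hpa, ihb hp.2.1 hp'.2.1 hlb hpb]

end

section

variable {V : Type}

/-! ### Melonic vacuum graphs in terms of separating sets of corners -/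

/-- The intermediate field representation of `τ` is connected, and every vertex is a bridge of it. -/
structure IsVacuumTree (τ : Equiv.Perm (V × Bool)) : Prop where
  conn : ∀ S : Set (V × Bool), S.Nonempty → (∀ x, τ x ∈ S ↔ x ∈ S) →
    (∀ x, x ∈ S → opp x ∈ S) → ∀ x, x ∈ S
  sep : ∀ v, ∃ S : Set (V × Bool), (∀ x, τ x ∈ S ↔ x ∈ S) ∧
    (∀ x, x.1 ≠ v → x ∈ S → opp x ∈ S) ∧ (v, false) ∈ S ∧ (v, true) ∉ S

theorem IsVacuumTree.sep_corner {τ : Equiv.Perm (V × Bool)} (h : IsVacuumTree τ) (y : V × Bool) :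
    ∃ S : Set (V × Bool), (∀ x, τ x ∈ S ↔ x ∈ S) ∧
      (∀ x, x.1 ≠ y.1 → x ∈ S → opp x ∈ S) ∧ y ∈ S ∧ opp y ∉ S := by
  obtain ⟨S, h1, h2, h3, h4⟩ := h.sep y.1
  rcases y with ⟨v, b⟩
  cases b
  · exact ⟨S, h1, h2, h3, h4⟩
  · refine ⟨Sᶜ, fun x => not_congr (h1 x), fun x hv hxS hc => hxS ?_, h4, fun hc => hc h3⟩
    simpa using h2 (opp x) hv hc

/-- A leaf `y` is attached only through its own vertex, which is thus separated by `{y}`. Deleting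
it leaves a tree on the other vertices, rooted at `opp y`. -/
theorem isVacuumTree_iff_of_leaf [Fintype V] {τ : Equiv.Perm (V × Bool)} {y : V × Bool}
    (hy : τ y = y) : IsVacuumTree τ ↔ IsRootedTree (Finset.univ.erase y.1) (opp y) τ := by
  have ne : ∀ x : V × Bool, x.1 ∈ Finset.univ.erase y.1 ↔ x.1 ≠ y.1 := by simp
  have hyi : ∀ x, τ x = y ↔ x = y := fun x =>
    ⟨fun e => τ.injective (e.trans hy.symm), fun e => by rw [e, hy]⟩
  constructor
  · intro h
    constructor
    · intro x hx hxA
      rw [ne, not_not] at hxA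
      rcases eq_or_eq_opp hxA with rfl | rfl
      · exact hy
      · exact absurd rfl hx
    · intro S hr hS ho x hx
      rw [ne] at hx
      have := h.conn (S ∪ {y}) ⟨y, Or.inr rfl⟩ (fun z => ?_) (fun z hz => ?_) x
      · rcases this with h1 | h1
        · exact h1
        · exact absurd (congrArg Prod.fst h1) hx
      · simp [hS, hyi]
      · by_cases hzy : z.1 = y.1
        · rcases eq_or_eq_opp hzy with rfl | rfl
          · exact Or.inl hr
          · exact Or.inr (by simp)
        · rcases hz with hz | hz
          · exact Or.inl (ho z ((ne z).2 hzy) hz)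
          · exact absurd (congrArg Prod.fst hz) hzy
    · intro v hv
      obtain ⟨S, h1, h2, h3⟩ := h.sep v
      exact ⟨S, h1, fun x _ => h2 x, h3⟩
  · intro h
    have hoppy : ∀ x : V × Bool, x ≠ y → x ≠ opp y → x.1 ≠ y.1 := fun x h1 h2 h3 => by
      rcases eq_or_eq_opp h3 with h3 | h3
      · exact h1 h3
      · exact h2 h3
    constructor
    · intro S hne hS ho
      have hoi : ∀ x, opp x ∈ S ↔ x ∈ S := fun x => ⟨fun hx => by simpa using ho _ hx, ho x⟩
      have hr : opp y ∈ S := by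
        by_contra hr
        obtain ⟨z, hz⟩ := hne
        have hyS : y ∉ S := fun hc => hr (ho y hc)
        have hzy : z.1 ≠ y.1 := hoppy z (by rintro rfl; exact hyS hz) (by rintro rfl; exact hr hz)
        exact h.conn Sᶜ hr (fun x => not_congr (hS x)) (fun x _ => (not_congr (hoi x)).2) z
          ((ne z).2 hzy) hz
      intro x
      by_cases h1 : x = y
      · subst h1; rwa [hoi] at hr
      · by_cases h2 : x = opp y
        · rwa [h2]
        · exact h.conn S hr hS (fun x _ => ho x) x ((ne x).2 (hoppy x h1 h2))
    · intro v
      by_cases hv : v = y.1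
      · subst hv
        rcases hb : y with ⟨w, b⟩
        cases b
        · refine ⟨{y}, fun x => by simp [hyi], fun x hx hxS => ?_, by simp [hb], by simp [hb]⟩
          rw [Set.mem_singleton_iff] at hxS
          rw [hxS, hb] at hx
          exact absurd rfl hx
        · refine ⟨{y}ᶜ, fun x => by simp [hyi], fun x hx hxS => ?_, by simp [hb], by simp [hb]⟩
          simp only [Set.mem_compl_iff, Set.mem_singleton_iff]
          intro e
          apply hx
          have := congrArg Prod.fst e
          rw [hb] at this
          exact this
      · obtain ⟨S, h1, h2, h3, h4⟩ := h.sep v (by simpa using hv)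
        have hinv : ∀ x, τ x ∈ S \ {y} ↔ x ∈ S \ {y} := fun x => by simp [h1, hyi]
        have hy' : ∀ b, (v, b) ≠ y := fun b e => hv (congrArg Prod.fst e)
        -- The leaf must lie on the same side as the opposite corner of its vertex, so it is added
        -- to `S` or removed from it accordingly.
        by_cases hr : opp y ∈ S
        · refine ⟨S ∪ {y}, fun x => by simp [h1, hyi], fun x hx hxS => ?_, Or.inl h3, ?_⟩
          · by_cases hxy : x.1 = y.1
            · rcases eq_or_eq_opp hxy with rfl | rfl
              · exact Or.inl hr
              · exact Or.inr (by simp)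
            · refine Or.inl (h2 x ((ne x).2 hxy) hx (hxS.resolve_right ?_))
              rintro rfl; exact hxy rfl
          · simp [h4, hy' true]
        · refine ⟨S \ {y}, hinv, fun x hx hxS => ?_, by simp [h3, hy' false], by simp [h4]⟩
          have hxy : x.1 ≠ y.1 := hoppy x hxS.2 (by rintro rfl; exact hr hxS.1)
          exact ⟨h2 x ((ne x).2 hxy) hx hxS.1, fun e => hxy (by
            rw [Set.mem_singleton_iff] at e; rw [← e]; rfl)⟩

theorem loopVertex_eq_iff {τ : Equiv.Perm (V × Bool)} {x y : V × Bool} :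
    loopVertex τ x = loopVertex τ y ↔ τ.SameCycle x y := Quotient.eq (r := Equiv.Perm.SameCycle.setoid τ)

theorem loopVertex_surjective (τ : Equiv.Perm (V × Bool)) : Function.Surjective (loopVertex τ) :=
  Quotient.mk_surjective

theorem mem_iff_of_sameCycle {α : Type*} {τ : Equiv.Perm α} {S : Set α}
    (hS : ∀ x, τ x ∈ S ↔ x ∈ S) {x y : α} (h : τ.SameCycle x y) : x ∈ S ↔ y ∈ S := by
  obtain ⟨k, rfl⟩ := h
  induction k with
  | zero => simp
  | succ k ih => rw [add_comm, zpow_add, Equiv.Perm.mul_apply, zpow_one, hS, ih]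
  | pred k ih =>
    rw [ih, sub_eq_add_neg, add_comm, zpow_add, Equiv.Perm.mul_apply, zpow_neg_one,
      ← hS (τ⁻¹ _)]
    simp

theorem loopVertex_apply (τ : Equiv.Perm (V × Bool)) (x : V × Bool) :
    loopVertex τ (τ x) = loopVertex τ x :=
  loopVertex_eq_iff.2 (Equiv.Perm.sameCycle_apply_left.2 (Equiv.Perm.SameCycle.refl _ _))

/-- The edge of the intermediate field representation given by a vertex. -/
def vertexEdge (τ : Equiv.Perm (V × Bool)) (v : V) : Sym2 (LoopVertex τ) :=
  s(loopVertex τ (v, false), loopVertex τ (v, true))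

theorem vertexEdge_eq (τ : Equiv.Perm (V × Bool)) (x : V × Bool) :
    vertexEdge τ x.1 = s(loopVertex τ x, loopVertex τ (opp x)) := by
  rcases x with ⟨v, b⟩
  cases b
  · rfl
  · exact Sym2.eq_swap

theorem intermediateGraph_adj_iff {τ : Equiv.Perm (V × Bool)} {p q : LoopVertex τ} :
    (intermediateGraph τ).Adj p q ↔ p ≠ q ∧ ∃ v, vertexEdge τ v = s(p, q) := by
  simp only [intermediateGraph, SimpleGraph.fromRel_adj, vertexEdge, Sym2.eq_iff]
  constructor
  · rintro ⟨h, ⟨v, h1, h2⟩ | ⟨v, h1, h2⟩⟩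
    · exact ⟨h, v, Or.inl ⟨h1.symm, h2.symm⟩⟩
    · exact ⟨h, v, Or.inr ⟨h1.symm, h2.symm⟩⟩
  · rintro ⟨h, v, ⟨h1, h2⟩ | ⟨h1, h2⟩⟩
    · exact ⟨h, Or.inl ⟨v, h1.symm, h2.symm⟩⟩
    · exact ⟨h, Or.inr ⟨v, h1.symm, h2.symm⟩⟩

theorem reachable_mem_of_closed {α : Type*} {G : SimpleGraph α} {S : Set α}
    (hS : ∀ x y, G.Adj x y → x ∈ S → y ∈ S) {x y : α} (h : G.Reachable x y) (hx : x ∈ S) :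
    y ∈ S := by
  obtain ⟨w⟩ := h
  induction w with
  | nil => exact hx
  | cons h _ ih => exact ih (hS _ _ h hx)

theorem preconnected_iff_closed {α : Type*} {G : SimpleGraph α} :
    G.Preconnected ↔
      ∀ S : Set α, S.Nonempty → (∀ x y, G.Adj x y → x ∈ S → y ∈ S) → ∀ x, x ∈ S := by
  constructor
  · rintro h S ⟨z, hz⟩ hS x
    exact reachable_mem_of_closed hS (h z x) hz
  · intro h x y
    exact h {z | G.Reachable x z} ⟨x, SimpleGraph.Reachable.refl x⟩
      (fun a b hab ha => SimpleGraph.Reachable.trans ha hab.reachable) y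

/-- Sets of loop-vertices correspond to `τ`-invariant sets of corners. This removes the quotient
from all later arguments. -/
theorem intermediateGraph_preconnected_iff (τ : Equiv.Perm (V × Bool)) :
    (intermediateGraph τ).Preconnected ↔ ∀ S : Set (V × Bool), S.Nonempty →
      (∀ x, τ x ∈ S ↔ x ∈ S) → (∀ x, x ∈ S → opp x ∈ S) → ∀ x, x ∈ S := by
  rw [preconnected_iff_closed]
  constructor
  · rintro h S ⟨z, hz⟩ hS ho x
    have := h (loopVertex τ '' S) ⟨_, z, hz, rfl⟩ ?_ (loopVertex τ x)
    · obtain ⟨w, hw, hwx⟩ := this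
      exact (mem_iff_of_sameCycle hS (loopVertex_eq_iff.1 hwx)).1 hw
    · rintro p q hpq ⟨w, hw, rfl⟩
      obtain ⟨_, v, hv⟩ := intermediateGraph_adj_iff.1 hpq
      have key : ∀ x : V × Bool, loopVertex τ x = loopVertex τ w → loopVertex τ (opp x) = q →
          q ∈ loopVertex τ '' S := fun x h1 h2 =>
        ⟨opp x, ho x ((mem_iff_of_sameCycle hS (loopVertex_eq_iff.1 h1)).2 hw), h2⟩
      rcases Sym2.eq_iff.1 hv with ⟨h1, h2⟩ | ⟨h1, h2⟩
      · exact key (v, false) h1 h2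
      · exact key (v, true) h2 h1
  · rintro h S ⟨z, hz⟩ hS p
    obtain ⟨x, rfl⟩ := loopVertex_surjective τ p
    obtain ⟨z, rfl⟩ := loopVertex_surjective τ z
    refine h (loopVertex τ ⁻¹' S) ⟨z, hz⟩ (fun x => ?_) (fun x hx => ?_) x
    · simp only [Set.mem_preimage, loopVertex_apply]
    · by_cases he : loopVertex τ x = loopVertex τ (opp x)
      · rw [Set.mem_preimage, ← he]; exact hx
      · exact hS _ _ (intermediateGraph_adj_iff.2 ⟨he, x.1, vertexEdge_eq τ x⟩) hx

/-- A connected multigraph has one node more than edges exactly when each edge is a bridge. Without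
vertices there is no loop-vertex and the left side fails, hence `Nonempty V`. -/
theorem isMelonicVacuum_iff [Fintype V] [Nonempty V] (τ : Equiv.Perm (V × Bool)) :
    IsMelonicVacuum τ ↔ IsVacuumTree τ := by
  have hne : Nonempty (LoopVertex τ) := ⟨loopVertex τ (Classical.arbitrary V, true)⟩
  constructor
  · rintro ⟨hconn, hcard⟩
    have hpre := (intermediateGraph_preconnected_iff τ).1 hconn.preconnected
    refine ⟨hpre, fun v => ?_⟩
    set H := SimpleGraph.fromEdgeSet (vertexEdge τ '' {v}ᶜ) with hH
    -- Without `v` at most `|V| - 1` edges remain, too few to connect `|V| + 1` nodes.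
    have hnot : ¬ H.Preconnected := by
      intro hc
      have h1 := SimpleGraph.Connected.card_vert_le_card_edgeSet_add_one
        { preconnected := hc, nonempty := hne }
      have h2 : Nat.card H.edgeSet ≤ Fintype.card V - 1 := by
        have h3 : H.edgeSet ⊆ vertexEdge τ '' {v}ᶜ := by
          rw [hH, SimpleGraph.edgeSet_fromEdgeSet]; exact Set.sdiff_subset
        calc Nat.card H.edgeSet = H.edgeSet.ncard := rfl
          _ ≤ (vertexEdge τ '' {v}ᶜ).ncard := Set.ncard_le_ncard h3 (Set.toFinite _)
          _ ≤ ({v}ᶜ : Set V).ncard := Set.ncard_image_le (Set.toFinite _)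
          _ = Fintype.card V - 1 := by
            rw [Set.ncard_compl, Set.ncard_singleton, Nat.card_eq_fintype_card]
      have h4 : 0 < Fintype.card V := Fintype.card_pos
      omega
    rw [preconnected_iff_closed] at hnot
    push Not at hnot
    obtain ⟨T, ⟨p, hp⟩, hT, q, hq⟩ := hnot
    have hTo : ∀ x : V × Bool, x.1 ≠ v → loopVertex τ x ∈ T → loopVertex τ (opp x) ∈ T := by
      intro x hx hxT
      by_cases he : loopVertex τ x = loopVertex τ (opp x)
      · rwa [← he]
      · refine hT _ _ ?_ hxT
        rw [hH, SimpleGraph.fromEdgeSet_adj]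
        exact ⟨⟨x.1, hx, vertexEdge_eq τ x⟩, he⟩
    -- If `v` did not cross the boundary of `T` either, no edge would, against the connectedness of
    -- the whole graph.
    have hsep : ¬ (loopVertex τ (v, false) ∈ T ↔ loopVertex τ (v, true) ∈ T) := by
      intro hc
      obtain ⟨x, rfl⟩ := loopVertex_surjective τ p
      obtain ⟨z, rfl⟩ := loopVertex_surjective τ q
      refine hq (hpre (loopVertex τ ⁻¹' T) ⟨x, hp⟩ (fun x => ?_) (fun x hx => ?_) z)
      · simp only [Set.mem_preimage, loopVertex_apply]
      · by_cases hxv : x.1 = v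
        · rcases x with ⟨w, b⟩
          obtain rfl : w = v := hxv
          cases b
          · exact hc.1 hx
          · exact hc.2 hx
        · exact hTo x hxv hx
    by_cases h0 : loopVertex τ (v, false) ∈ T
    · refine ⟨loopVertex τ ⁻¹' T, fun x => ?_, hTo, h0, fun h1 => hsep (iff_of_true h0 h1)⟩
      simp only [Set.mem_preimage, loopVertex_apply]
    · refine ⟨(loopVertex τ ⁻¹' T)ᶜ, fun x => ?_, fun x hx hxT hc => hxT ?_, h0, fun h1 =>
        hsep (iff_of_false h0 h1)⟩
      · simp only [Set.mem_compl_iff, Set.mem_preimage, loopVertex_apply]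
      · simpa using hTo (opp x) hx hc
  · intro h
    have hconn : (intermediateGraph τ).Connected :=
      { preconnected := (intermediateGraph_preconnected_iff τ).2 h.conn, nonempty := hne }
    refine ⟨hconn, ?_⟩
    have hsepne : ∀ v, loopVertex τ (v, false) ≠ loopVertex τ (v, true) := by
      intro v he
      obtain ⟨S, h1, -, h3, h4⟩ := h.sep v
      exact h4 ((mem_iff_of_sameCycle h1 (loopVertex_eq_iff.1 he)).1 h3)
    have hstep : ∀ {S : Set (V × Bool)} (_ : ∀ x, τ x ∈ S ↔ x ∈ S) {v : V}
        (_ : ∀ x, x.1 ≠ v → x ∈ S → opp x ∈ S) {w : V} (_ : w ≠ v) {x z : V × Bool}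
        (_ : vertexEdge τ w = s(loopVertex τ x, loopVertex τ z)), x ∈ S → z ∈ S := by
      intro S h1 v h2 w hw x z he hx
      rcases Sym2.eq_iff.1 he with ⟨e1, e2⟩ | ⟨e1, e2⟩
      · rw [← mem_iff_of_sameCycle h1 (loopVertex_eq_iff.1 e2)]
        refine h2 (w, false) hw ?_
        rwa [mem_iff_of_sameCycle h1 (loopVertex_eq_iff.1 e1)]
      · rw [← mem_iff_of_sameCycle h1 (loopVertex_eq_iff.1 e1)]
        refine h2 (w, true) hw ?_
        rwa [mem_iff_of_sameCycle h1 (loopVertex_eq_iff.1 e2)]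
    -- A parallel edge would cross the separating set of `v`, so passing from the multigraph to the
    -- simple graph loses no edge.
    have hinj : Function.Injective (vertexEdge τ) := by
      intro w v he
      by_contra hw
      obtain ⟨S, h1, h2, h3, h4⟩ := h.sep v
      exact h4 (hstep h1 h2 hw he h3)
    have hedge : (intermediateGraph τ).edgeSet = Set.range (vertexEdge τ) := by
      ext e
      induction e using Sym2.ind with
      | _ p q =>
        rw [SimpleGraph.mem_edgeSet, intermediateGraph_adj_iff]
        refine ⟨fun hh => hh.2, ?_⟩
        rintro ⟨v, hv⟩
        refine ⟨?_, v, hv⟩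
        rintro rfl
        rcases Sym2.eq_iff.1 hv with ⟨e1, e2⟩ | ⟨e1, e2⟩ <;> exact hsepne v (e1.trans e2.symm)
    have hacyc : (intermediateGraph τ).IsAcyclic := by
      rw [SimpleGraph.isAcyclic_iff_forall_isBridge]
      intro e he
      rw [hedge] at he
      obtain ⟨v, rfl⟩ := he
      obtain ⟨S, h1, h2, h3, h4⟩ := h.sep v
      rw [vertexEdge, SimpleGraph.isBridge_iff]
      intro hr
      have := reachable_mem_of_closed (S := loopVertex τ '' S) ?_ hr ⟨_, h3, rfl⟩
      · obtain ⟨z, hz, hzv⟩ := this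
        exact h4 ((mem_iff_of_sameCycle h1 (loopVertex_eq_iff.1 hzv)).1 hz)
      · rintro p q hpq ⟨x, hx, rfl⟩
        obtain ⟨z, rfl⟩ := loopVertex_surjective τ q
        rw [SimpleGraph.deleteEdges_adj, intermediateGraph_adj_iff] at hpq
        obtain ⟨⟨-, w, hw⟩, hne⟩ := hpq
        refine ⟨z, hstep h1 h2 (w := w) ?_ hw hx, rfl⟩
        rintro rfl
        exact hne hw.symm
    have := (SimpleGraph.IsTree.mk hconn hacyc).card_edgeFinset
    rw [Nat.card_eq_fintype_card, ← this, ← Nat.card_eq_fintype_card (α := V),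
      ← Set.ncard_coe_finset, SimpleGraph.coe_edgeFinset, hedge]
    congr 1
    rw [← Set.image_univ, Set.ncard_image_of_injective _ hinj, Set.ncard_univ]

end

section

variable {V : Type}

/-! ### One-particle irreducibility of cut vacuum trees -/

theorem IsCut.apply_inl_eq_inl_iff {N : ℕ} {τ : Equiv.Perm (V × Bool)} {ℓ : Fin N ↪ V × Bool}
    {σ : Wick V N} (h : IsCut τ ℓ σ) {x z : V × Bool} :
    σ (Sum.inl x) = Sum.inl z ↔ (∀ k, x ≠ ℓ k) ∧ τ x = z := by
  obtain ⟨π, h1, h2⟩ := h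
  constructor
  · intro hx
    by_cases hc : ∀ k, x ≠ ℓ k
    · rw [h1 x hc] at hx
      exact ⟨hc, Sum.inl_injective hx⟩
    · push Not at hc
      obtain ⟨k, rfl⟩ := hc
      rw [(h2 k).1] at hx
      cases hx
  · rintro ⟨hc, rfl⟩
    exact h1 x hc

theorem lineGraph_adj_iff {N : ℕ} {σ : Wick V N} {D : Set (Leg V N)} {v w : V} :
    (lineGraph σ D).Adj v w ↔ v ≠ w ∧
      ((∃ b b', (Sum.inl (v, b) : Leg V N) ∉ D ∧ σ (Sum.inl (v, b)) = Sum.inl (w, b')) ∨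
        ∃ b b', (Sum.inl (w, b) : Leg V N) ∉ D ∧ σ (Sum.inl (w, b)) = Sum.inl (v, b')) := by
  rw [lineGraph, SimpleGraph.fromRel_adj]

/-- With `y = τ (ℓ k)`, the vertex of `y` together with the branch beyond `opp y` meets the
remaining vertices only through the two lines at the corner `y`: the incoming one is cut, and the
outgoing one is external or in `D`. -/
theorem IsCut.not_preconnected {N : ℕ} {τ : Equiv.Perm (V × Bool)} {ℓ : Fin N ↪ V × Bool}
    {σ : Wick V N} (h : IsCut τ ℓ σ) (hτ : IsVacuumTree τ) {k : Fin N} (hk : τ (ℓ k) ≠ ℓ k)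
    {D : Set (Leg V N)} (hD : ∀ z, σ (Sum.inl (τ (ℓ k))) = Sum.inl z → Sum.inl (τ (ℓ k)) ∈ D) :
    ¬ (lineGraph σ D).Preconnected := by
  set y := τ (ℓ k) with hy
  obtain ⟨S, s1, s2, s3, s4⟩ := hτ.sep_corner (opp y)
  rw [opp_opp] at s4
  have mS : ∀ x : V × Bool, x.1 ≠ y.1 → ((x.1, true) ∈ S ↔ x ∈ S) := by
    rintro ⟨v, b⟩ hx
    cases b
    · exact ⟨fun hh => s2 (v, true) hx hh, fun hh => s2 (v, false) hx hh⟩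
    · rfl
  -- Away from the corner `y`, the set of vertices used below corresponds exactly to `S`.
  have hB : ∀ p : V × Bool, p ≠ y → (p.1 = y.1 ∨ (p.1, true) ∈ S ↔ p ∈ S) := by
    intro p hp
    by_cases hpy : p.1 = y.1
    · rcases eq_or_eq_opp hpy with rfl | rfl
      · exact absurd rfl hp
      · exact iff_of_true (Or.inl rfl) s3
    · rw [mS p hpy]; tauto
  have hstep : ∀ p q : V × Bool, Sum.inl p ∉ D → σ (Sum.inl p) = Sum.inl q →
      ((p.1 = y.1 ∨ (p.1, true) ∈ S) ↔ (q.1 = y.1 ∨ (q.1, true) ∈ S)) := by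
    intro p q hp hpq
    have hpy : p ≠ y := by rintro rfl; exact hp (hD q hpq)
    obtain ⟨h1, rfl⟩ := h.apply_inl_eq_inl_iff.1 hpq
    have hqy : τ p ≠ y := fun e => h1 k (τ.injective e)
    rw [hB p hpy, hB _ hqy, s1]
  rw [preconnected_iff_closed]
  intro hc
  have := hc {w | w = y.1 ∨ (w, true) ∈ S} ⟨y.1, Or.inl rfl⟩ ?_ (ℓ k).1
  · have h1 : ℓ k ∈ S := (hB (ℓ k) hk.symm).1 this
    rw [← s1] at h1
    exact s4 h1
  · intro v w hvw hv
    rw [lineGraph_adj_iff] at hvw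
    rcases hvw.2 with ⟨b, b', hb, he⟩ | ⟨b, b', hb, he⟩
    · exact (hstep _ _ hb he).1 hv
    · exact (hstep _ _ hb he).2 hv

/-- A finite cycle cannot cross the boundary of a set just once: `τ` maps `S \ {x₀}` onto `S \ {τ
x₀}`, so these sets have equal size and `S` contains both of `x₀`, `τ x₀` or neither. -/
theorem perm_mem_iff_of_forall_ne {α : Type*} [Finite α] (τ : Equiv.Perm α) (S : Set α)
    (x₀ : α) (h : ∀ x, x ≠ x₀ → (τ x ∈ S ↔ x ∈ S)) (x : α) : τ x ∈ S ↔ x ∈ S := by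
  by_cases hx : x = x₀
  · subst hx
    have himg : τ '' (S \ {x}) = S \ {τ x} := by
      ext z
      constructor
      · rintro ⟨w, hw, rfl⟩
        exact ⟨(h w hw.2).2 hw.1, fun e => hw.2 (τ.injective e)⟩
      · rintro ⟨hz, hz'⟩
        obtain ⟨w, rfl⟩ := τ.surjective z
        have hw : w ≠ x := by rintro rfl; exact hz' rfl
        exact ⟨w, ⟨(h w hw).1 hz, hw⟩, rfl⟩
    have hcard : (S \ {x}).ncard = (S \ {τ x}).ncard := by
      rw [← himg, Set.ncard_image_of_injective _ τ.injective]
    by_cases h1 : x ∈ S <;> by_cases h2 : τ x ∈ S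
    · simp [h1, h2]
    · rw [Set.sdiff_singleton_eq_self h2] at hcard
      have := Set.ncard_sdiff_singleton_lt_of_mem h1 (Set.toFinite S)
      omega
    · rw [Set.sdiff_singleton_eq_self h1] at hcard
      have := Set.ncard_sdiff_singleton_lt_of_mem h2 (Set.toFinite S)
      omega
    · simp [h1, h2]
  · exact h x hx

/-- Cut leaves join a vertex to itself, hence do not affect connectivity. One more deleted line `x₀`
is harmless because the rest of its cycle still connects its ends. -/
theorem IsCut.preconnected_of_leaves [Fintype V] {N : ℕ} {τ : Equiv.Perm (V × Bool)}
    {ℓ : Fin N ↪ V × Bool} {σ : Wick V N} (h : IsCut τ ℓ σ) (hτ : IsVacuumTree τ)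
    (hk : ∀ k, τ (ℓ k) = ℓ k) (x₀ : V × Bool) {D : Set (Leg V N)}
    (hD : ∀ x, Sum.inl x ∈ D → x = x₀) : (lineGraph σ D).Preconnected := by
  rw [preconnected_iff_closed]
  rintro B ⟨v, hv⟩ hB w
  refine hτ.conn {x | x.1 ∈ B} ⟨(v, true), hv⟩ ?_ (fun x hx => hx) (w, true)
  apply perm_mem_iff_of_forall_ne _ _ x₀
  intro x hx
  by_cases hc : ∀ k, x ≠ ℓ k
  · have hσ : σ (Sum.inl x) = Sum.inl (τ x) := h.apply_inl_eq_inl_iff.2 ⟨hc, rfl⟩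
    have hxD : Sum.inl x ∉ D := fun hh => hx (hD x hh)
    by_cases he : x.1 = (τ x).1
    · simp only [Set.mem_ofPred_eq, ← he]
    · have hadj : (lineGraph σ D).Adj x.1 (τ x).1 :=
        lineGraph_adj_iff.2 ⟨he, Or.inl ⟨x.2, (τ x).2, hxD, hσ⟩⟩
      exact ⟨hB _ _ hadj.symm, hB _ _ hadj⟩
  · push Not at hc
    obtain ⟨k, rfl⟩ := hc
    rw [hk]

theorem IsCut.isOnePI_iff [Fintype V] [Nonempty V] {N : ℕ} {τ : Equiv.Perm (V × Bool)}
    {ℓ : Fin N ↪ V × Bool} {σ : Wick V N} (h : IsCut τ ℓ σ) (hτ : IsVacuumTree τ) :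
    IsOnePI σ ↔ ∀ k, τ (ℓ k) = ℓ k := by
  constructor
  · rintro ⟨h1, h2⟩ k
    by_contra hk
    by_cases hi : IsInternal σ (Sum.inl (τ (ℓ k)))
    · exact h.not_preconnected hτ hk (D := {Sum.inl (τ (ℓ k))}) (by simp) (h2 _ hi).preconnected
    -- Here the outgoing line is itself external, and the graph is disconnected before any deletion.
    · refine h.not_preconnected hτ hk (fun z hz => ?_) h1.preconnected
      exact absurd ⟨rfl, by rw [hz]; rfl⟩ hi
  · intro hk
    have x₀ : V × Bool := (Classical.arbitrary V, true)
    refine ⟨⟨h.preconnected_of_leaves hτ hk x₀ (by simp)⟩, ?_⟩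
    rintro (x | k) hx
    · exact ⟨h.preconnected_of_leaves hτ hk x (by simp)⟩
    · exact ⟨h.preconnected_of_leaves hτ hk x₀ (by simp)⟩

end

section

variable {V : Type} {d : ℕ}

/-! ### Momentum conservation in melonic vacuum graphs -/

/-- Both halves of a cut leaf are external lines at the same corner. When all external momenta equal
`p`, the constraints are those of the vacuum graph with the cut lines held at `p`. -/
theorem compatible_iff_of_leaves {N : ℕ} {τ : Equiv.Perm (V × Bool)} {ℓ : Fin N ↪ V × Bool}
    {σ : Wick V N} (h : IsCut τ ℓ σ) (hk : ∀ k, τ (ℓ k) = ℓ k) (c : V → Fin d) (p : Momentum d)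
    (P : Leg V N → Momentum d) :
    Compatible c σ (fun _ => p) (fun _ => p) P ↔ (∀ k, P (Sum.inr k) = p) ∧
      (∀ k, P (Sum.inl (ℓ k)) = p) ∧
      ∀ y j, P (Sum.inl (τ.symm y)) j = P (Sum.inl (partner c j y)) j := by
  obtain ⟨π, h1, h2⟩ := h
  have e1 : ∀ k, σ.symm (Sum.inr k) = Sum.inl (ℓ k) := fun k => by
    rw [Equiv.symm_apply_eq, (h2 k).1]
  have e2 : ∀ k, σ.symm (Sum.inl (ℓ k)) = Sum.inr (π k) := fun k => by
    rw [Equiv.symm_apply_eq, (h2 k).2, hk]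
  have e3 : ∀ y, (∀ k, y ≠ ℓ k) → σ.symm (Sum.inl y) = Sum.inl (τ.symm y) := fun y hy => by
    rw [Equiv.symm_apply_eq, h1, Equiv.apply_symm_apply]
    intro k hc
    rw [Equiv.symm_apply_eq, hk] at hc
    exact hy k hc
  have e4 : ∀ k, τ.symm (ℓ k) = ℓ k := fun k => by rw [Equiv.symm_apply_eq, hk]
  simp only [Compatible, e1]
  have key : (∀ k, P (Sum.inr k) = p) → (∀ k, P (Sum.inl (ℓ k)) = p) →
      ∀ y, P (σ.symm (Sum.inl y)) = P (Sum.inl (τ.symm y)) := by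
    intro k1 k2 y
    by_cases hy : ∀ k, y ≠ ℓ k
    · rw [e3 y hy]
    · push Not at hy
      obtain ⟨k, rfl⟩ := hy
      rw [e2, e4, k1, k2]
  constructor
  · rintro ⟨k1, k2, k3⟩
    exact ⟨k2, k1, fun y j => by rw [← key k2 k1]; exact k3 y j⟩
  · rintro ⟨k1, k2, k3⟩
    exact ⟨k2, k1, fun y j => by rw [key k1 k2]; exact k3 y j⟩

/-! ### Amplitudes of trees -/

/-- The momenta `P` are constant along the loop-vertices of the tree `t` with root `r`, and the
component of the colour of a vertex is the same on both sides of that vertex. -/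
def IsConserved (c : V → Fin d) : BinaryTree (V × Bool) → V × Bool → (V × Bool → Momentum d) → Prop
  | .nil, _, _ => True
  | .node y a b, r, P => P y = P r ∧ P (opp y) (c y.1) = P r (c y.1) ∧
      IsConserved c a (opp y) P ∧ IsConserved c b r P

theorem isConserved_congr {c : V → Fin d} {t : BinaryTree (V × Bool)} {r : V × Bool}
    {P P' : V × Bool → Momentum d} (h : ∀ x, InDom t r x → P x = P' x) :
    IsConserved c t r P ↔ IsConserved c t r P' := by
  induction t generalizing r with
  | nil => rfl
  | node y a b iha ihb =>
    simp only [inDom_node] at h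
    simp only [IsConserved]
    rw [h y (Or.inl rfl), h r (Or.inr (Or.inr (Or.inl rfl))),
      h (opp y) (Or.inr (Or.inl (Or.inl rfl))), iha fun x hx => h x (Or.inr (Or.inl hx)),
      ihb fun x hx => h x (Or.inr (Or.inr hx))]

theorem isConserved_iff {c : V → Fin d} {t : BinaryTree (V × Bool)} {r : V × Bool}
    (h : Proper t r) {P : V × Bool → Momentum d} :
    IsConserved c t r P ↔ (∀ x, P (treePerm t r x) = P x) ∧
      ∀ v ∈ labels t, P (v, false) (c v) = P (v, true) (c v) := by
  induction t generalizing r with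
  | nil => simp [IsConserved, treePerm, labels]
  | node y a b iha ihb =>
    have hp := Proper.node_iff.1 h
    have e0 := treePerm_node_root h
    have e1 := treePerm_node_self h
    have e2 : ∀ x, InDom a (opp y) x → _ := fun x => treePerm_node_left h
    have e3 : ∀ x, InDom b r x → x ≠ r → _ := fun x => treePerm_node_right h
    have fa := treePerm_of_not_inDom a (opp y)
    have fb := treePerm_of_not_inDom b r
    have hy : P (opp y) (c y.1) = P y (c y.1) ↔ P (y.1, false) (c y.1) = P (y.1, true) (c y.1) := by
      rcases y with ⟨v, b⟩
      cases b
      · exact eq_comm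
      · rfl
    rw [IsConserved, iha hp.1, ihb hp.2.1]
    simp only [labels, List.mem_cons, List.mem_append]
    constructor
    · rintro ⟨h1, h2, ⟨h3, h4⟩, h5, h6⟩
      refine ⟨fun x => ?_, ?_⟩
      · by_cases hx : InDom (.node y a b) r x
        · by_cases hxr : x = r
          · rw [hxr, e0, h1]
          · rcases inDom_node.1 hx with rfl | hx | hx
            · rw [e1, h5, h1]
            · rw [e2 x hx, h3]
            · rw [e3 x hx hxr, h5]
        · rw [treePerm_of_not_inDom _ _ x hx]
      · rintro v (rfl | hv | hv)
        · rw [← hy, h2, h1]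
        · exact h4 v hv
        · exact h6 v hv
    · rintro ⟨h1, h2⟩
      have hyr : P y = P r := by rw [← e0, h1]
      refine ⟨hyr, ?_, ⟨fun x => ?_, fun v hv => h2 v (Or.inr (Or.inl hv))⟩, fun x => ?_,
        fun v hv => h2 v (Or.inr (Or.inr hv))⟩
      · rw [← hyr, hy]; exact h2 _ (Or.inl rfl)
      · by_cases hx : InDom a (opp y) x
        · rw [← e2 x hx, h1]
        · rw [fa x hx]
      · by_cases hx : InDom b r x
        · by_cases hxr : x = r
          · rw [hxr, ← e1, h1, hyr]
          · rw [← e3 x hx hxr, h1]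
        · rw [fb x hx]

/-- The amplitude of the tree `t` with root `r` of momentum `q`, where the line `x` with momentum
`k` has the weight `g x k`, and all momenta are in `K`. -/
def treeAmplitude (c : V → Fin d) (K : Finset (Momentum d)) (g : V × Bool → Momentum d → ℝ) :
    BinaryTree (V × Bool) → V × Bool → Momentum d → ℝ
  | .nil, r, q => g r q
  | .node y a b, r, q => g y q * treeAmplitude c K g b r q *
      ∑ k ∈ K with k (c y.1) = q (c y.1), treeAmplitude c K g a (opp y) k

theorem treeAmplitude_congr {c : V → Fin d} {K : Finset (Momentum d)}
    {g g' : V × Bool → Momentum d → ℝ} {t : BinaryTree (V × Bool)} {r : V × Bool}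
    (h : ∀ x, InDom t r x → g x = g' x) :
    treeAmplitude c K g t r = treeAmplitude c K g' t r := by
  induction t generalizing r with
  | nil => ext q; simp [treeAmplitude, h r (Or.inl rfl)]
  | node y a b iha ihb =>
    simp only [inDom_node] at h
    ext q
    simp only [treeAmplitude]
    rw [h y (Or.inl rfl), iha fun x hx => h x (Or.inr (Or.inl hx)),
      ihb fun x hx => h x (Or.inr (Or.inr hx))]

variable [Fintype V]

/-- The conserved momenta in `K` of the lines of the tree `t`, the root momentum being in `T`. -/
def treeMomenta (c : V → Fin d) (K : Finset (Momentum d)) (t : BinaryTree (V × Bool))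
    (r : V × Bool) (T : Finset (Momentum d)) : Finset (V × Bool → Momentum d) :=
  (Fintype.piFinset fun x => if InDom t r x then K else {0}).filter fun P =>
    IsConserved c t r P ∧ P r ∈ T

theorem mem_treeMomenta {c : V → Fin d} {K : Finset (Momentum d)} {t : BinaryTree (V × Bool)}
    {r : V × Bool} {T : Finset (Momentum d)} {P : V × Bool → Momentum d} :
    P ∈ treeMomenta c K t r T ↔ (∀ x, InDom t r x → P x ∈ K) ∧ (∀ x, ¬ InDom t r x → P x = 0) ∧
      IsConserved c t r P ∧ P r ∈ T := by
  simp only [treeMomenta, Finset.mem_filter, Fintype.mem_piFinset]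
  constructor
  · rintro ⟨h1, h2⟩
    refine ⟨fun x hx => by simpa [hx] using h1 x, fun x hx => by simpa [hx] using h1 x, h2⟩
  · rintro ⟨h1, h2, h3⟩
    refine ⟨fun x => ?_, h3⟩
    by_cases hx : InDom t r x
    · simpa [hx] using h1 x hx
    · simpa [hx] using h2 x hx

theorem sum_treeMomenta_fiberwise {c : V → Fin d} {K : Finset (Momentum d)}
    (t : BinaryTree (V × Bool)) (r : V × Bool) (T : Finset (Momentum d))
    (f : (V × Bool → Momentum d) → ℝ) :
    ∑ P ∈ treeMomenta c K t r T, f P = ∑ q ∈ T, ∑ P ∈ treeMomenta c K t r {q}, f P := by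
  rw [← Finset.sum_fiberwise_of_maps_to (s := treeMomenta c K t r T) (g := fun P => P r) (t := T)
    fun P hP => (mem_treeMomenta.1 hP).2.2.2]
  refine Finset.sum_congr rfl fun q hq => Finset.sum_congr ?_ fun _ _ => rfl
  ext P
  simp only [Finset.mem_filter, mem_treeMomenta, Finset.mem_singleton]
  constructor
  · rintro ⟨⟨h1, h2, h3, -⟩, h4⟩; exact ⟨h1, h2, h3, h4⟩
  · rintro ⟨h1, h2, h3, h4⟩; exact ⟨⟨h1, h2, h3, h4 ▸ hq⟩, h4⟩

/-- The sum factorises at the root: `y` and the right subtree carry the root momentum `q`, while the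
momentum entering the left branch is only constrained in the component of colour `c y.1`. -/
theorem sum_treeMomenta_singleton {c : V → Fin d} {K : Finset (Momentum d)}
    {t : BinaryTree (V × Bool)} {r : V × Bool} (h : Proper t r) {q : Momentum d} (hq : q ∈ K)
    (g : V × Bool → Momentum d → ℝ) :
    ∑ P ∈ treeMomenta c K t r {q}, ∏ x with InDom t r x, g x (P x) = treeAmplitude c K g t r q := by
  induction t generalizing r q with
  | nil =>
    have h1 : treeMomenta c K .nil r {q} = {fun x => if x = r then q else 0} := by
      ext P
      simp only [mem_treeMomenta, InDom, labels, List.not_mem_nil, or_false, IsConserved,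
        true_and, Finset.mem_singleton]
      constructor
      · rintro ⟨-, h2, h3⟩
        ext1 x
        by_cases hx : x = r
        · simp [hx, h3]
        · simp [hx, h2 x hx]
      · rintro rfl
        exact ⟨by rintro x rfl; simpa using hq, fun x hx => by simp [hx], by simp⟩
    rw [h1, Finset.sum_singleton]
    simp [InDom, labels, treeAmplitude, Finset.filter_eq']
  | node y a b iha ihb =>
    have hp := Proper.node_iff.1 h
    have hya := h.not_inDom_left_self
    have hyb := h.not_inDom_right_self
    have hd : ∀ x, InDom a (opp y) x → ¬ InDom b r x := fun x => h.disjoint_inDom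
    have ra : InDom a (opp y) (opp y) := Or.inl rfl
    have rb : InDom b r r := Or.inl rfl
    have hra : ¬ InDom a (opp y) r := fun hh => hd r hh rb
    have hry : r ≠ y := h.ne_root.symm
    rw [treeAmplitude, ← ihb hp.2.1 hq, ← Finset.sum_congr rfl fun k hk =>
      iha hp.1 (Finset.mem_filter.1 hk).1, ← sum_treeMomenta_fiberwise, mul_assoc,
      Finset.sum_mul_sum, ← Finset.sum_product', Finset.mul_sum]
    have hprod : ∀ f : V × Bool → ℝ, ∏ x with InDom (.node y a b) r x, f x =
        f y * ((∏ x with InDom b r x, f x) * ∏ x with InDom a (opp y) x, f x) := by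
      intro f
      have : Finset.univ.filter (InDom (.node y a b) r) = insert y
          (Finset.univ.filter (InDom b r) ∪ Finset.univ.filter (InDom a (opp y))) := by
        ext x
        simp only [Finset.mem_filter, Finset.mem_univ, true_and, inDom_node, Finset.mem_insert,
          Finset.mem_union]
        tauto
      rw [this, Finset.prod_insert (by simp [hya, hyb]), Finset.prod_union]
      rw [Finset.disjoint_left]
      intro x hx hx'
      simp only [Finset.mem_filter, Finset.mem_univ, true_and] at hx hx'
      exact hd x hx' hx
    -- Momenta on the tree correspond to pairs of momenta on the subtrees, extended by `0` off their
    -- domains; on `y` the value `q` is forced.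
    refine Finset.sum_nbij'
      (fun P => (fun x => if InDom b r x then P x else 0,
        fun x => if InDom a (opp y) x then P x else 0))
      (fun Q x => if InDom a (opp y) x then Q.2 x else if x = y then q else Q.1 x) ?_ ?_ ?_ ?_ ?_
    · intro P hP
      rw [mem_treeMomenta] at hP
      obtain ⟨h1, h2, ⟨h3, h4, h5, h6⟩, h7⟩ := hP
      rw [Finset.mem_singleton] at h7
      rw [Finset.mem_product, mem_treeMomenta, mem_treeMomenta]
      refine ⟨⟨fun x hx => ?_, fun x hx => if_neg hx, ?_, ?_⟩,
        ⟨fun x hx => ?_, fun x hx => if_neg hx, ?_, ?_⟩⟩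
      · simpa [hx] using h1 x (inDom_node.2 (Or.inr (Or.inr hx)))
      · exact (isConserved_congr fun x hx => by simp [hx]).2 h6
      · simp [rb, h7]
      · simpa [hx] using h1 x (inDom_node.2 (Or.inr (Or.inl hx)))
      · exact (isConserved_congr fun x hx => by simp [hx]).2 h5
      · simp only [ra, if_true, Finset.mem_filter]
        exact ⟨h1 _ (inDom_node.2 (Or.inr (Or.inl ra))), by rw [h4, h7]⟩
    · rintro ⟨Q2, Q1⟩ hQ
      rw [Finset.mem_product, mem_treeMomenta, mem_treeMomenta] at hQ
      obtain ⟨⟨h1, h2, h3, h4⟩, ⟨k1, k2, k3, k4⟩⟩ := hQ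
      rw [Finset.mem_singleton] at h4
      rw [Finset.mem_filter] at k4
      rw [mem_treeMomenta]
      simp only at *
      refine ⟨fun x hx => ?_, fun x hx => ?_, ⟨?_, ?_, ?_, ?_⟩, ?_⟩
      · by_cases hxa : InDom a (opp y) x
        · simpa [hxa] using k1 x hxa
        · by_cases hxy : x = y
          · subst hxy; simpa [hya] using hq
          · simpa [hxa, hxy] using h1 x (((inDom_node.1 hx).resolve_left hxy).resolve_left hxa)
      · rw [inDom_node] at hx
        push Not at hx
        simp [hx.1, hx.2.1, h2 x hx.2.2]
      · simp [hya, hra, hry, h4]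
      · simp [ra, hra, hry, h4, k4.2]
      · exact (isConserved_congr fun x hx => by simp [hx]).2 k3
      · refine (isConserved_congr fun x hx => ?_).2 h3
        have hxa : ¬ InDom a (opp y) x := fun hh => hd x hh hx
        have hxy : x ≠ y := by rintro rfl; exact hyb hx
        simp [hxa, hxy]
      · simp [hra, hry, h4]
    · intro P hP
      rw [mem_treeMomenta] at hP
      obtain ⟨h1, h2, ⟨h3, h4, h5, h6⟩, h7⟩ := hP
      rw [Finset.mem_singleton] at h7
      ext1 x
      by_cases hxa : InDom a (opp y) x
      · simp [hxa]
      · by_cases hxy : x = y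
        · subst hxy; simp [hya, h3, h7]
        · by_cases hxb : InDom b r x
          · simp [hxa, hxy, hxb]
          · simp [hxa, hxy, hxb, h2 x (by rw [inDom_node]; tauto)]
    · rintro ⟨Q2, Q1⟩ hQ
      rw [Finset.mem_product, mem_treeMomenta, mem_treeMomenta] at hQ
      obtain ⟨⟨h1, h2, h3, h4⟩, ⟨k1, k2, k3, k4⟩⟩ := hQ
      simp only at *
      ext1
      · ext1 x
        by_cases hx : InDom b r x
        · have hxa : ¬ InDom a (opp y) x := fun hh => hd x hh hx
          have hxy : x ≠ y := by rintro rfl; exact hyb hx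
          simp [hx, hxa, hxy]
        · simp [hx, h2 x hx]
      · ext1 x
        by_cases hx : InDom a (opp y) x
        · simp [hx]
        · simp [hx, k2 x hx]
    · intro P hP
      rw [mem_treeMomenta] at hP
      obtain ⟨h1, h2, ⟨h3, h4, h5, h6⟩, h7⟩ := hP
      rw [Finset.mem_singleton] at h7
      rw [hprod, h3, h7]
      congr 2
      · exact Finset.prod_congr rfl fun x hx => by simp [(Finset.mem_filter.1 hx).2]
      · exact Finset.prod_congr rfl fun x hx => by simp [(Finset.mem_filter.1 hx).2]

theorem sum_treeMomenta {c : V → Fin d} {K : Finset (Momentum d)}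
    {t : BinaryTree (V × Bool)} {r : V × Bool} (h : Proper t r) {T : Finset (Momentum d)}
    (hT : T ⊆ K) (g : V × Bool → Momentum d → ℝ) :
    ∑ P ∈ treeMomenta c K t r T, ∏ x with InDom t r x, g x (P x) =
      ∑ q ∈ T, treeAmplitude c K g t r q := by
  rw [sum_treeMomenta_fiberwise]
  exact Finset.sum_congr rfl fun q hq => sum_treeMomenta_singleton h (hT hq) g

/-- The vertex constraints act like a conserved flow of each component through the graph. Across a
bridge, the flow entering one side equals the flow leaving it, which identifies the component of
colour `c v` on the two corners of `v`. -/
theorem vacuum_conservation_iff {τ : Equiv.Perm (V × Bool)} (hτ : IsVacuumTree τ) (c : V → Fin d)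
    (Q : V × Bool → Momentum d) :
    (∀ y j, Q (τ.symm y) j = Q (partner c j y) j) ↔
      (∀ x, Q (τ x) = Q x) ∧ ∀ v, Q (v, false) (c v) = Q (v, true) (c v) := by
  have hpart : (∀ v, Q (v, false) (c v) = Q (v, true) (c v)) →
      ∀ j x, Q (partner c j x) j = Q x j := by
    rintro h j ⟨v, b⟩
    by_cases hj : c v = j
    · subst hj
      cases b <;> simp [partner, h]
    · simp [partner, hj]
  constructor
  · intro h
    have h2 : ∀ v, Q (v, false) (c v) = Q (v, true) (c v) := by
      intro v
      obtain ⟨S, s1, s2, s3, s4⟩ := hτ.sep v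
      -- `τ` permutes `S`.
      have e1 : ∑ x ∈ S.toFinset, Q (τ.symm x) (c v) = ∑ x ∈ S.toFinset, Q x (c v) := by
        refine Finset.sum_nbij' τ.symm τ ?_ ?_ ?_ ?_ ?_
        · intro x hx; rw [Set.mem_toFinset] at hx ⊢; rw [← s1]; simpa using hx
        · intro x hx; rw [Set.mem_toFinset] at hx ⊢; rwa [s1]
        all_goals simp
      -- `partner` permutes `S` apart from `(v, false)`, which it sends across the bridge to `(v,
      -- true)`. Comparing with `e1` isolates this single term.
      have e2 : ∑ x ∈ S.toFinset.erase (v, false), Q (partner c (c v) x) (c v) =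
          ∑ x ∈ S.toFinset.erase (v, false), Q x (c v) := by
        have hm : ∀ x ∈ S.toFinset.erase (v, false),
            partner c (c v) x ∈ S.toFinset.erase (v, false) := by
          intro x hx
          rw [Finset.mem_erase, Set.mem_toFinset] at hx
          have hxv : x.1 ≠ v := by
            rintro rfl
            rcases x with ⟨v, b⟩
            cases b
            · exact hx.1 rfl
            · exact s4 hx.2
          rw [Finset.mem_erase, Set.mem_toFinset]
          by_cases hc : c x.1 = c v
          · have : partner c (c v) x = opp x := by simp [partner, hc, opp]
            rw [this]
            exact ⟨fun e => hxv (by simpa using congrArg Prod.fst e), s2 x hxv hx.2⟩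
          · have : partner c (c v) x = x := by simp [partner, hc]
            rwa [this]
        have hinv : ∀ x, partner c (c v) (partner c (c v) x) = x := by
          rintro ⟨w, b⟩
          by_cases hc : c w = c v <;> simp [partner, hc]
        exact Finset.sum_nbij' (partner c (c v)) (partner c (c v)) hm hm
          (fun x _ => hinv x) (fun x _ => hinv x) (fun x _ => rfl)
      have hv : (v, false) ∈ S.toFinset := by simpa using s3
      rw [Finset.sum_congr rfl fun x _ => h x (c v), ← Finset.add_sum_erase _ _ hv,
        ← Finset.add_sum_erase _ _ hv, e2] at e1
      have := add_right_cancel e1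
      rw [← this]
      simp [partner]
    refine ⟨fun x => ?_, h2⟩
    ext1 j
    have := h (τ x) j
    rw [hpart h2] at this
    simpa using this.symm
  · rintro ⟨h1, h2⟩ y j
    rw [hpart h2]
    have := h1 (τ.symm y)
    rw [Equiv.apply_symm_apply] at this
    rw [this]

end

/-! ### Amplitudes of cut graphs as sums over tree momenta. -/

section

variable {V : Type} {d : ℕ}

theorem IsCut.prod_internal [Fintype V] {N : ℕ} {τ : Equiv.Perm (V × Bool)}
    {ℓ : Fin N ↪ V × Bool} {σ : Wick V N} (h : IsCut τ ℓ σ) (f : Leg V N → ℝ) :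
    ∏ x with IsInternal σ x, f x = ∏ z with ∀ k, z ≠ ℓ k, f (Sum.inl z) := by
  rw [Finset.prod_filter, Finset.prod_filter, Fintype.prod_sum_type]
  have h1 : ∀ z, IsInternal σ (Sum.inl z) ↔ ∀ k, z ≠ ℓ k := by
    intro z
    rw [IsInternal, Sum.isLeft_iff (x := σ _)]
    constructor
    · rintro ⟨-, w, hw⟩; exact (h.apply_inl_eq_inl_iff.1 hw).1
    · intro hz; exact ⟨rfl, _, h.apply_inl_eq_inl_iff.2 ⟨hz, rfl⟩⟩
  have h2 : ∀ k, ¬ IsInternal σ (Sum.inr k) := fun k hk => by simp [IsInternal] at hk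
  simp only [h1, h2, if_false, Finset.prod_const_one, mul_one]

/-- The weight of a line of a graph all of whose cut lines have the momentum `p`. -/
def cutWeight {N : ℕ} (η m Λ : ℝ) (ℓ : Fin N → V × Bool) (p : Momentum d) (x : V × Bool)
    (q : Momentum d) : ℝ :=
  if ∀ k, x ≠ ℓ k then propagator η m Λ q else if q = p then 1 else 0

/-- The leaf `ℓ k₀` is the attachment point and carries `p`, which fixes one component of the root
momentum. Every other cut line belongs to the tree and contributes a Kronecker delta at `p`; it is
for these lines that `p ∈ K` is required. -/
theorem IsCut.amplitude_eq [Fintype V] {N : ℕ} {τ : Equiv.Perm (V × Bool)} {ℓ : Fin N ↪ V × Bool}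
    {σ : Wick V N} (h : IsCut τ ℓ σ) (hτ : IsVacuumTree τ) (hk : ∀ k, τ (ℓ k) = ℓ k) (k₀ : Fin N)
    {a : BinaryTree (V × Bool)} (ha : Proper a (opp (ℓ k₀)))
    (hl : ∀ v, v ∈ labels a ↔ v ≠ (ℓ k₀).1) (hperm : treePerm a (opp (ℓ k₀)) = τ)
    {η m Λ : ℝ} {K : Finset (Momentum d)} (hK : ∀ q, propagator η m Λ q ≠ 0 → q ∈ K)
    {p : Momentum d} (hp : p ∈ K ∨ ∀ k, k = k₀) (c : V → Fin d) :
    amplitude η m Λ c σ (fun _ => p) (fun _ => p) =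
      ∑ q ∈ K with q (c (ℓ k₀).1) = p (c (ℓ k₀).1),
        treeAmplitude c K (cutWeight η m Λ ℓ p) a (opp (ℓ k₀)) q := by
  set y := ℓ k₀ with hy
  have hdom : ∀ x, InDom a (opp y) x ↔ x ≠ y := by
    intro x
    rw [InDom, hl]
    constructor
    · rintro (h1 | h1) h2
      · exact opp_ne y (h1.symm.trans h2)
      · exact h1 (by rw [h2])
    · intro hx
      by_cases hxy : x.1 = y.1
      · exact Or.inl ((eq_or_eq_opp hxy).resolve_left hx)
      · exact Or.inr hxy
  have hyi : ∀ x, τ x = y ↔ x = y := fun x =>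
    ⟨fun e => τ.injective (e.trans (hk k₀).symm), fun e => by rw [e, hk]⟩
  have hcol : ∀ Q : V × Bool → Momentum d, ∀ v, Q (v, false) (c v) = Q (v, true) (c v) ↔
      ∀ b, Q (opp (v, b)) (c v) = Q (v, b) (c v) := by
    intro Q v
    simp only [opp, Bool.forall_bool, Bool.not_false, Bool.not_true]
    tauto
  set T := K.filter fun q => q (c y.1) = p (c y.1) with hT
  set M := treeMomenta c K a (opp y) T with hM
  set f : (Leg V N → Momentum d) → ℝ :=
    fun P => ∏ x with IsInternal σ x, propagator η m Λ (P x) with hf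
  set E : (V × Bool → Momentum d) → Leg V N → Momentum d :=
    fun P => Sum.elim (fun x => if x = y then p else P x) (fun _ => p) with hE
  have hEinj : Set.InjOn E (M.filter fun P => ∀ k, k ≠ k₀ → P (ℓ k) = p) := by
    intro P hP P' hP' he
    rw [Finset.mem_coe, Finset.mem_filter, mem_treeMomenta] at hP hP'
    ext1 x
    by_cases hx : x = y
    · rw [hP.1.2.1 x (by simp [hdom, hx]), hP'.1.2.1 x (by simp [hdom, hx])]
    · simpa [hE, hx] using congrFun he (Sum.inl x)
  have hprod : ∀ P, f (E P) = ∏ z with ∀ k, z ≠ ℓ k, propagator η m Λ (P z) := by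
    intro P
    simp only [hf]
    rw [h.prod_internal]
    refine Finset.prod_congr rfl fun z hz => ?_
    have : z ≠ y := (Finset.mem_filter.1 hz).2 k₀
    simp [hE, this]
  -- The comparison is made on the support of the product of propagators, where all internal momenta
  -- lie in `K` and the sum becomes finite.
  have hset : {P | Compatible c σ (fun _ => p) (fun _ => p) P} ∩ Function.support f =
      ↑((M.filter fun P => ∀ k, k ≠ k₀ → P (ℓ k) = p).image E) ∩ Function.support f := by
    ext P
    simp only [Set.mem_inter_iff, Set.mem_ofPred_eq, Finset.coe_image, Set.mem_image,
      Finset.mem_coe, Finset.mem_filter, compatible_iff_of_leaves h hk, Function.mem_support]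
    refine and_congr_left fun hfP => ?_
    constructor
    · rintro ⟨h1, h2, h3⟩
      rw [vacuum_conservation_iff hτ c (fun x => P (Sum.inl x))] at h3
      -- The cut line `y` lies outside the tree and takes the default value `0` of `treeMomenta`.
      refine ⟨fun x => if x = y then 0 else P (Sum.inl x), ⟨?_, ?_⟩, ?_⟩
      · rw [hM, mem_treeMomenta, isConserved_iff ha, hperm]
        refine ⟨fun x hx => ?_, fun x hx => ?_, ⟨fun x => ?_, fun v hv => ?_⟩, ?_⟩
        · rw [hdom] at hx
          simp only [if_neg hx]
          by_cases hc : ∀ k, x ≠ ℓ k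
          · refine hK _ fun h0 => hfP ?_
            simp only [hf]
            rw [h.prod_internal]
            exact Finset.prod_eq_zero (Finset.mem_filter.2 ⟨Finset.mem_univ x, hc⟩) h0
          · push Not at hc
            obtain ⟨k, rfl⟩ := hc
            rw [h2]
            exact hp.resolve_right fun hh => hx (by rw [hh k])
        · rw [hdom, not_not] at hx
          simp [hx]
        · by_cases hx : x = y
          · simp [hx, hy, hk]
          · simp [hyi, hx, h3.1]
        · rw [hl] at hv
          have hv' : ∀ b, (v, b) ≠ y := fun b e => hv (by rw [← e])
          simp [hv', h3.2]
        · have h4 := (hcol (fun x => P (Sum.inl x)) y.1).1 (h3.2 y.1) y.2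
          have h5 : P (Sum.inl y) = p := h2 k₀
          rw [Prod.mk.eta, h5] at h4
          simp only [if_neg (opp_ne y), hT, Finset.mem_filter]
          refine ⟨?_, h4⟩
          by_cases hc : ∀ k, opp y ≠ ℓ k
          · refine hK _ fun h0 => hfP ?_
            simp only [hf]
            rw [h.prod_internal]
            exact Finset.prod_eq_zero (Finset.mem_filter.2 ⟨Finset.mem_univ _, hc⟩) h0
          · push Not at hc
            obtain ⟨k, hk'⟩ := hc
            rw [hk', h2]
            exact hp.resolve_right fun hh => opp_ne y (by rw [hk', hh k])
      · intro k hkk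
        have : ℓ k ≠ y := fun e => hkk (ℓ.injective e)
        simp [this, h2]
      · ext1 x
        rcases x with x | k
        · by_cases hx : x = y
          · subst hx; simp [hE, hy, h2]
          · simp [hE, hx]
        · simp [hE, h1]
    · rintro ⟨Q, ⟨hQ, hQ2⟩, rfl⟩
      rw [hM, mem_treeMomenta, isConserved_iff ha, hperm] at hQ
      obtain ⟨h1, h2, ⟨h3, h4⟩, h5⟩ := hQ
      rw [hT, Finset.mem_filter] at h5
      refine ⟨fun k => rfl, fun k => ?_, ?_⟩
      · by_cases hkk : k = k₀
        · subst hkk; simp [hE, ← hy]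
        · have : ℓ k ≠ y := fun e => hkk (ℓ.injective e)
          simp [hE, this, hQ2 k hkk]
      · rw [vacuum_conservation_iff hτ c (fun x => E Q (Sum.inl x))]
        refine ⟨fun x => ?_, fun v => ?_⟩
        · by_cases hx : x = y
          · simp [hE, hx, hy, hk]
          · simp [hE, hyi, hx, h3]
        · by_cases hv : v = y.1
          · subst hv
            have h6 := h5.2
            rcases hyy : y with ⟨w, b⟩
            rw [hyy] at h6
            cases b
            · simpa [hE, hyy, opp] using h6.symm
            · simpa [hE, hyy, opp] using h6
          · have hv' : ∀ b, (v, b) ≠ y := fun b e => hv (by rw [← e])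
            simpa [hE, hv'] using h4 v ((hl v).2 hv)
  rw [amplitude, finsum_mem_eq_sum_of_inter_support_eq f hset, Finset.sum_image hEinj,
    ← sum_treeMomenta ha (Finset.filter_subset _ _), Finset.sum_filter]
  refine Finset.sum_congr rfl fun P _ => ?_
  rw [hprod]
  have hsplit : (Finset.univ.filter fun x => InDom a (opp y) x) =
      (Finset.univ.filter fun z => ∀ k, z ≠ ℓ k) ∪
        (Finset.univ.filter fun z => z ≠ y ∧ ∃ k, z = ℓ k) := by
    ext x
    simp only [Finset.mem_filter, Finset.mem_univ, true_and, hdom, Finset.mem_union]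
    constructor
    · intro hx
      by_cases hc : ∀ k, x ≠ ℓ k
      · exact Or.inl hc
      · push Not at hc; exact Or.inr ⟨hx, hc⟩
    · rintro (h1 | h1)
      · exact h1 k₀
      · exact h1.1
  rw [hsplit, Finset.prod_union]
  · have hcut : ∏ z with ∀ k, z ≠ ℓ k, cutWeight η m Λ ℓ p z (P z) =
        ∏ z with ∀ k, z ≠ ℓ k, propagator η m Λ (P z) :=
      Finset.prod_congr rfl fun z hz => if_pos (Finset.mem_filter.1 hz).2
    rw [hcut]
    split_ifs with hc
    · rw [Finset.prod_eq_one (s := Finset.univ.filter fun z => z ≠ y ∧ ∃ k, z = ℓ k), mul_one]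
      intro z hz
      obtain ⟨hz1, k, rfl⟩ := (Finset.mem_filter.1 hz).2
      rw [cutWeight, if_neg (by push Not; exact ⟨k, rfl⟩), if_pos]
      exact hc k fun e => hz1 (by rw [e])
    · push Not at hc
      obtain ⟨k, hk1, hk2⟩ := hc
      rw [Finset.prod_eq_zero (s := Finset.univ.filter fun z => z ≠ y ∧ ∃ k, z = ℓ k)
        (i := ℓ k), mul_zero]
      · exact Finset.mem_filter.2 ⟨Finset.mem_univ _, fun e => hk1 (ℓ.injective e), k, rfl⟩
      · rw [cutWeight, if_neg (by push Not; exact ⟨k, rfl⟩), if_neg hk2]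
  · rw [Finset.disjoint_left]
    intro z hz hz'
    obtain ⟨-, k, rfl⟩ := (Finset.mem_filter.1 hz').2
    exact (Finset.mem_filter.1 hz).2 k rfl

end

section

variable {V : Type} {d : ℕ}

/-! ### Faces of trees -/

/-- The lines of the tree `t` on the face of colour `i` of its root `r`. -/
def faceLines (c : V → Fin d) (i : Fin d) : BinaryTree (V × Bool) → V × Bool → Set (V × Bool)
  | .nil, r => {r}
  | .node y a b, r => {y} ∪ faceLines c i b r ∪ {x | c y.1 = i ∧ x ∈ faceLines c i a (opp y)}

theorem root_mem_faceLines (c : V → Fin d) (i : Fin d) (t : BinaryTree (V × Bool))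
    (r : V × Bool) : r ∈ faceLines c i t r := by
  induction t generalizing r with
  | nil => exact rfl
  | node y a b _ ihb => exact Or.inl (Or.inr (ihb r))

theorem inDom_of_mem_faceLines {c : V → Fin d} {i : Fin d} {t : BinaryTree (V × Bool)}
    {r x : V × Bool} (hx : x ∈ faceLines c i t r) : InDom t r x := by
  induction t generalizing r with
  | nil => exact Or.inl hx
  | node y a b iha ihb =>
    rw [inDom_node]
    rcases hx with (hx | hx) | ⟨-, hx⟩
    · exact Or.inl hx
    · exact Or.inr (Or.inr (ihb hx))
    · exact Or.inr (Or.inl (iha hx))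

theorem partner_of_eq {c : V → Fin d} {i : Fin d} {x : V × Bool} (h : c x.1 = i) :
    partner c i x = opp x := by simp [partner, h, opp]

theorem partner_of_ne {c : V → Fin d} {i : Fin d} {x : V × Bool} (h : c x.1 ≠ i) :
    partner c i x = x := by simp [partner, h]

/-- The last line of the root's cycle is on the root's face whatever the colours: the face returns
from each branch to the corner at which it entered it. -/
theorem mem_faceLines_of_treePerm_eq_root {c : V → Fin d} {i : Fin d}
    {t : BinaryTree (V × Bool)} {r x : V × Bool} (h : Proper t r) (hx : treePerm t r x = r) :
    x ∈ faceLines c i t r := by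
  induction t generalizing r with
  | nil => exact hx
  | node y a b _ ihb =>
    have hp := Proper.node_iff.1 h
    by_cases h0 : treePerm b r r = r
    · have : x = y := (treePerm (.node y a b) r).injective
        (hx.trans (h0.symm.trans (treePerm_node_self h).symm))
      exact Or.inl (Or.inl this)
    · obtain ⟨w, hw⟩ := (treePerm b r).surjective r
      have hwr : w ≠ r := by rintro rfl; exact h0 hw
      have hwd : InDom b r w := by rw [← inDom_treePerm, hw]; exact Or.inl rfl
      have : x = w := (treePerm (.node y a b) r).injective
        (hx.trans (hw.symm.trans (treePerm_node_right h hwd hwr).symm))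
      subst this
      exact Or.inl (Or.inr (ihb hp.2.1 hw))

/-- Together with `faceLines_subset` this identifies the recursively defined lines with the face of
the root. The excluded case is the step by which the face leaves the tree through its root. -/
theorem partner_mem_faceLines {c : V → Fin d} {i : Fin d} {t : BinaryTree (V × Bool)}
    {r x : V × Bool} (h : Proper t r) (hx : x ∈ faceLines c i t r) (hr : treePerm t r x ≠ r) :
    partner c i (treePerm t r x) ∈ faceLines c i t r := by
  induction t generalizing r x with
  | nil => exact absurd hx hr
  | node y a b iha ihb =>
    have hp := Proper.node_iff.1 h
    have hyb : y ∈ faceLines c i (.node y a b) r := Or.inl (Or.inl rfl)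
    by_cases hxr : x = r
    · rw [hxr, treePerm_node_root h]
      by_cases hy : c y.1 = i
      · rw [partner_of_eq hy]
        exact Or.inr ⟨hy, root_mem_faceLines _ _ _ _⟩
      · rwa [partner_of_ne hy]
    · rcases hx with (hx | hx) | ⟨hy, hx⟩
      · rw [Set.mem_singleton_iff] at hx
        subst hx
        rw [treePerm_node_self h] at hr ⊢
        exact Or.inl (Or.inr (ihb hp.2.1 (root_mem_faceLines _ _ _ _) hr))
      · rw [treePerm_node_right h (inDom_of_mem_faceLines hx) hxr] at hr ⊢
        exact Or.inl (Or.inr (ihb hp.2.1 hx hr))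
      · rw [treePerm_node_left h (inDom_of_mem_faceLines hx)]
        by_cases h0 : treePerm a (opp y) x = opp y
        · rw [h0, partner_of_eq (by simpa using hy), opp_opp]
          exact hyb
        · exact Or.inr ⟨hy, iha hp.1 hx h0⟩

theorem faceLines_subset {c : V → Fin d} {i : Fin d} {t : BinaryTree (V × Bool)} {r : V × Bool}
    (h : Proper t r) {S : Set (V × Bool)} (hr : r ∈ S)
    (hS : ∀ x, InDom t r x → x ∈ S → treePerm t r x ≠ r → partner c i (treePerm t r x) ∈ S) :
    faceLines c i t r ⊆ S := by
  induction t generalizing r with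
  | nil => rintro x rfl; exact hr
  | node y a b iha ihb =>
    have hp := Proper.node_iff.1 h
    have hyr := h.ne_root
    have hy := hS r (inDom_node.2 (Or.inr (Or.inr (Or.inl rfl)))) hr
      (by rwa [treePerm_node_root h])
    rw [treePerm_node_root h] at hy
    have hA : c y.1 = i → faceLines c i a (opp y) ⊆ S := by
      intro hc
      rw [partner_of_eq hc] at hy
      refine iha hp.1 hy fun x hx hxS hxr => ?_
      have h1 := hS x (inDom_node.2 (Or.inr (Or.inl hx))) hxS
      rw [treePerm_node_left h hx] at h1
      refine h1 fun e => h.disjoint_inDom (x := r) ?_ (Or.inl rfl)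
      rw [← e, inDom_treePerm]; exact hx
    -- When the colour of the vertex is `i`, the face enters the left branch first; `y` is reached
    -- afterwards, through the last line `w` of the cycle of `opp y`.
    have hyS : y ∈ S := by
      by_cases hc : c y.1 = i
      · obtain ⟨w, hw⟩ := (treePerm a (opp y)).surjective (opp y)
        have hwf := mem_faceLines_of_treePerm_eq_root (c := c) (i := i) hp.1 hw
        have hwd := inDom_of_mem_faceLines hwf
        have h1 := hS w (inDom_node.2 (Or.inr (Or.inl hwd))) (hA hc hwf)
        rw [treePerm_node_left h hwd, hw, partner_of_eq (by simpa using hc), opp_opp] at h1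
        refine h1 fun e => hp.2.2.1 ?_
        rw [← e]; rfl
      · rwa [partner_of_ne hc] at hy
    have hB : faceLines c i b r ⊆ S := by
      refine ihb hp.2.1 hr fun x hx hxS hxr => ?_
      by_cases hxe : x = r
      · have h1 := hS y (inDom_node.2 (Or.inl rfl)) hyS
        rw [treePerm_node_self h] at h1
        rw [hxe] at hxr ⊢
        exact h1 hxr
      · have h1 := hS x (inDom_node.2 (Or.inr (Or.inr hx))) hxS
        rw [treePerm_node_right h hx hxe] at h1
        exact h1 hxr
    rintro x ((hx | hx) | ⟨hc, hx⟩)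
    · rw [Set.mem_singleton_iff] at hx; rwa [hx]
    · exact hB hx
    · exact hA hc hx

/-- The lines of the tree `t` that are fixed by its permutation and lie on the face of colour `i` of
its root `r`. -/
def faceLeaves (c : V → Fin d) (i : Fin d) :
    BinaryTree (V × Bool) → V × Bool → Finset (V × Bool)
  | .nil, r => {r}
  | .node y a b, r =>
    (if c y.1 = i then faceLeaves c i a (opp y) else ∅) ∪ (faceLeaves c i b r).erase r

theorem mem_faceLeaves {c : V → Fin d} {i : Fin d} {t : BinaryTree (V × Bool)}
    {r x : V × Bool} (h : Proper t r) :
    x ∈ faceLeaves c i t r ↔ x ∈ faceLines c i t r ∧ treePerm t r x = x := by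
  induction t generalizing r with
  | nil => simp [faceLeaves, faceLines, treePerm]
  | node y a b iha ihb =>
    have hp := Proper.node_iff.1 h
    rw [faceLeaves, Finset.mem_union, Finset.mem_erase, ihb hp.2.1]
    have h1 : x ∈ (if c y.1 = i then faceLeaves c i a (opp y) else ∅) ↔
        c y.1 = i ∧ x ∈ faceLines c i a (opp y) ∧ treePerm a (opp y) x = x := by
      by_cases hc : c y.1 = i
      · simp [hc, iha hp.1]
      · simp [hc]
    rw [h1]
    constructor
    · rintro (⟨hc, hx, hxe⟩ | ⟨hxr, hx, hxe⟩)
      · exact ⟨Or.inr ⟨hc, hx⟩, by rw [treePerm_node_left h (inDom_of_mem_faceLines hx), hxe]⟩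
      · exact ⟨Or.inl (Or.inr hx), by
          rw [treePerm_node_right h (inDom_of_mem_faceLines hx) hxr, hxe]⟩
    · rintro ⟨(hx | hx) | ⟨hc, hx⟩, hxe⟩
      · rw [Set.mem_singleton_iff] at hx
        subst hx
        exact absurd ((treePerm _ r).injective (hxe.trans (treePerm_node_root h).symm)) h.ne_root
      · have hxr : x ≠ r := by
          rintro rfl
          rw [treePerm_node_root h] at hxe
          exact h.ne_root hxe
        rw [treePerm_node_right h (inDom_of_mem_faceLines hx) hxr] at hxe
        exact Or.inr ⟨hxr, hx, hxe⟩
      · rw [treePerm_node_left h (inDom_of_mem_faceLines hx)] at hxe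
        exact Or.inl ⟨hc, hx, hxe⟩

/-- From the leaf `y` the face crosses to `opp y` only if its vertex has colour `i`, then runs
through the tree and returns to `y`. For another colour, `y` alone is its face. -/
theorem sameCycle_facePerm_iff [Fintype V] {c : V → Fin d} {i : Fin d} {y x : V × Bool}
    {a : BinaryTree (V × Bool)} (ha : Proper a (opp y)) {τ : Equiv.Perm (V × Bool)}
    (hτ : treePerm a (opp y) = τ) (hx : x ≠ y) :
    (facePerm c τ i).SameCycle y x ∧ τ x = x ↔ c y.1 = i ∧ x ∈ faceLeaves c i a (opp y) := by
  subst hτ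
  rw [mem_faceLeaves ha, ← and_assoc]
  refine and_congr_left fun _ => ?_
  have hya : ¬ InDom a (opp y) y := by
    rintro (h | h)
    · exact opp_ne y h.symm
    · exact ha.2 h
  have hy : treePerm a (opp y) y = y := treePerm_of_not_inDom _ _ _ hya
  constructor
  · intro h
    have hc : c y.1 = i := by
      by_contra hc
      have hfix : facePerm c (treePerm a (opp y)) i y = y := by
        rw [facePerm, Equiv.Perm.mul_apply, hy, partner_of_ne hc]
      exact hx (h.eq_of_left hfix).symm
    refine ⟨hc, ?_⟩
    obtain ⟨k, -, hk⟩ := h.exists_pow_eq'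
    have key : ∀ k : ℕ, (facePerm c (treePerm a (opp y)) i ^ k) y ∈
        ({y} ∪ faceLines c i a (opp y) : Set (V × Bool)) := by
      intro k
      induction k with
      | zero => exact Or.inl rfl
      | succ k ih =>
        rw [pow_succ', Equiv.Perm.mul_apply]
        generalize (facePerm c (treePerm a (opp y)) i ^ k) y = z at ih
        rw [facePerm, Equiv.Perm.mul_apply]
        rcases ih with ih | ih
        · rw [Set.mem_singleton_iff] at ih
          rw [ih, hy, partner_of_eq hc]
          exact Or.inr (root_mem_faceLines _ _ _ _)
        · by_cases h0 : treePerm a (opp y) z = opp y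
          · rw [h0, partner_of_eq (by simpa using hc), opp_opp]
            exact Or.inl rfl
          · exact Or.inr (partner_mem_faceLines ha ih h0)
    rcases hk ▸ key k with h1 | h1
    · exact absurd h1 hx
    · exact h1
  · rintro ⟨hc, h⟩
    refine faceLines_subset (S := {z | (facePerm c (treePerm a (opp y)) i).SameCycle y z}) ha ?_ ?_ h
    · refine ⟨1, ?_⟩
      rw [zpow_one, facePerm, Equiv.Perm.mul_apply, hy, partner_of_eq hc]
    · intro z _ hz _
      exact Equiv.Perm.sameCycle_apply_right.2 hz

/-! ### Amplitudes of coloured trees -/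

/-- The amplitude of a tree of colours, its root having the momentum `q`. -/
def colorAmplitude (K : Finset (Momentum d)) (C : Momentum d → ℝ) :
    BinaryTree (Fin d) → Momentum d → ℝ
  | .nil, q => C q
  | .node j a b, q => C q * colorAmplitude K C b q * ∑ k ∈ K with k j = q j, colorAmplitude K C a k

/-- The amplitude of the empty tree whose only line is cut and has the momentum `p`. -/
def cutRoot (p : Momentum d) : BinaryTree (Fin d) → Momentum d → ℝ
  | .nil, q => if q = p then 1 else 0
  | .node _ _ _, _ => 0

/-- The sum of the amplitudes of a tree of colours with one leaf other than the root cut, on the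
face of colour `i` of the root, and having the momentum `p`. -/
def markedAmplitude (K : Finset (Momentum d)) (C : Momentum d → ℝ) (i : Fin d) (p : Momentum d) :
    BinaryTree (Fin d) → Momentum d → ℝ
  | .nil, _ => 0
  | .node j a b, q =>
    C q * ((if j = i then colorAmplitude K C b q *
        ∑ k ∈ K with k j = q j, (markedAmplitude K C i p a k + cutRoot p a k) else 0) +
      markedAmplitude K C i p b q * ∑ k ∈ K with k j = q j, colorAmplitude K C a k)

theorem treeAmplitude_const (c : V → Fin d) (K : Finset (Momentum d)) (C : Momentum d → ℝ)
    (t : BinaryTree (V × Bool)) (r : V × Bool) (q : Momentum d) :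
    treeAmplitude c K (fun _ => C) t r q = colorAmplitude K C (t.map fun y => c y.1) q := by
  induction t generalizing r q with
  | nil => rfl
  | node y a b iha ihb => simp only [treeAmplitude, BinaryTree.map, colorAmplitude, iha, ihb]

/-- The weights of the lines when the line `x` is cut and has the momentum `p`. -/
def markWeight (C : Momentum d → ℝ) (p : Momentum d) (x z : V × Bool) (q : Momentum d) : ℝ :=
  if z = x then if q = p then 1 else 0 else C q

theorem treeAmplitude_markWeight {c : V → Fin d} {K : Finset (Momentum d)} {C : Momentum d → ℝ}
    {p : Momentum d} {t : BinaryTree (V × Bool)} {r x : V × Bool} (hx : ¬ InDom t r x)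
    (q : Momentum d) :
    treeAmplitude c K (markWeight C p x) t r q = colorAmplitude K C (t.map fun y => c y.1) q := by
  rw [← treeAmplitude_const c K C t r]
  refine congrFun (treeAmplitude_congr fun z hz => ?_) q
  have : z ≠ x := by rintro rfl; exact hx hz
  ext1 k
  simp [markWeight, this]

/-- The cut leaf lies either in the left branch, which requires the colour `i` at the root, or in
the right subtree. `cutRoot` accounts for the tree whose root line is itself the leaf. -/
theorem sum_faceLeaves {c : V → Fin d} {i : Fin d} {K : Finset (Momentum d)}
    {C : Momentum d → ℝ} {p : Momentum d} {t : BinaryTree (V × Bool)} {r : V × Bool}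
    (h : Proper t r) (q : Momentum d) :
    ∑ x ∈ faceLeaves c i t r, treeAmplitude c K (markWeight C p x) t r q =
      markedAmplitude K C i p (t.map fun y => c y.1) q +
        cutRoot p (t.map fun y => c y.1) q := by
  induction t generalizing r q with
  | nil => simp [faceLeaves, treeAmplitude, markWeight, markedAmplitude, cutRoot, BinaryTree.map]
  | node y a b iha ihb =>
    have hp := Proper.node_iff.1 h
    have domA : ∀ x ∈ faceLeaves c i a (opp y), InDom a (opp y) x := fun x hx =>
      inDom_of_mem_faceLines ((mem_faceLeaves hp.1).1 hx).1
    have domB : ∀ x ∈ faceLeaves c i b r, InDom b r x := fun x hx =>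
      inDom_of_mem_faceLines ((mem_faceLeaves hp.2.1).1 hx).1
    have hdisj : Disjoint (if c y.1 = i then faceLeaves c i a (opp y) else ∅)
        ((faceLeaves c i b r).erase r) := by
      rw [Finset.disjoint_left]
      intro x hx hx'
      split_ifs at hx
      · exact h.disjoint_inDom (domA x hx) (domB x (Finset.mem_of_mem_erase hx'))
      · simp at hx
    -- Erasing `r` matters only for an empty right subtree: `r` is a leaf there, but not in the
    -- whole tree.
    have hB : ∑ x ∈ (faceLeaves c i b r).erase r, treeAmplitude c K (markWeight C p x) b r q =
        markedAmplitude K C i p (b.map fun y => c y.1) q := by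
      cases b with
      | nil => simp [faceLeaves, markedAmplitude, BinaryTree.map]
      | node z a' b' =>
        have hr : r ∉ faceLeaves c i (.node z a' b') r := by
          rw [mem_faceLeaves hp.2.1, treePerm_node_root hp.2.1]
          exact fun hc => hp.2.1.ne_root hc.2
        rw [Finset.erase_eq_of_notMem hr, ihb hp.2.1]
        simp [BinaryTree.map, cutRoot]
    simp only [faceLeaves, Finset.sum_union hdisj, BinaryTree.map, markedAmplitude, cutRoot,
      add_zero, treeAmplitude, mul_add]
    congr 1
    · by_cases hc : c y.1 = i
      · rw [if_pos hc, if_pos hc]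
        have : ∀ x ∈ faceLeaves c i a (opp y), markWeight C p x y q *
            treeAmplitude c K (markWeight C p x) b r q *
            ∑ k ∈ K with k (c y.1) = q (c y.1),
              treeAmplitude c K (markWeight C p x) a (opp y) k =
            C q * (colorAmplitude K C (b.map fun y => c y.1) q *
            ∑ k ∈ K with k (c y.1) = q (c y.1),
              treeAmplitude c K (markWeight C p x) a (opp y) k) := by
          intro x hx
          have hd := domA x hx
          have hyx : y ≠ x := by rintro rfl; exact h.not_inDom_left_self hd
          rw [treeAmplitude_markWeight (h.disjoint_inDom hd), markWeight, if_neg hyx, mul_assoc]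
        rw [Finset.sum_congr rfl this, ← Finset.mul_sum, ← Finset.mul_sum, Finset.sum_comm]
        congr 2
        exact Finset.sum_congr rfl fun k _ => iha hp.1 k
      · simp [hc]
    · have : ∀ x ∈ (faceLeaves c i b r).erase r, markWeight C p x y q *
            treeAmplitude c K (markWeight C p x) b r q *
            ∑ k ∈ K with k (c y.1) = q (c y.1),
              treeAmplitude c K (markWeight C p x) a (opp y) k =
            C q * (∑ k ∈ K with k (c y.1) = q (c y.1),
              colorAmplitude K C (a.map fun y => c y.1) k) *
              treeAmplitude c K (markWeight C p x) b r q := by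
        intro x hx
        have hd := domB x (Finset.mem_of_mem_erase hx)
        have hyx : y ≠ x := by rintro rfl; exact h.not_inDom_right_self hd
        rw [Finset.sum_congr rfl fun k _ => treeAmplitude_markWeight
          (fun hh => h.disjoint_inDom hh hd) k, markWeight, if_neg hyx]
        ring
      rw [Finset.sum_congr rfl this, ← Finset.mul_sum, hB]
      ring

end

section

/-! ### Enumeration of labelled trees -/

section Trees

variable {α β : Type*}

/-- The labels of a tree in prefix order. -/
def flat : BinaryTree α → List α
  | .nil => []
  | .node x a b => x :: (flat a ++ flat b)

/-- The tree of a given shape with given labels in prefix order. -/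
def fill : BinaryTree Unit → List α → BinaryTree α
  | .nil, _ => .nil
  | .node _ _ _, [] => .nil
  | .node _ a b, x :: l => .node x (fill a (l.take a.numNodes)) (fill b (l.drop a.numNodes))

theorem length_flat (t : BinaryTree α) : (flat t).length = t.numNodes := by
  induction t with
  | nil => rfl
  | node x a b iha ihb => simp [flat, BinaryTree.numNodes, iha, ihb]

theorem numNodes_map (f : α → β) (t : BinaryTree α) : (t.map f).numNodes = t.numNodes := by
  induction t with
  | nil => rfl
  | node x a b iha ihb => simp [BinaryTree.map, BinaryTree.numNodes, iha, ihb]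

theorem fill_flat (t : BinaryTree α) : fill (t.map fun _ => ()) (flat t) = t := by
  induction t with
  | nil => rfl
  | node x a b iha ihb =>
    simp only [BinaryTree.map, flat, fill, numNodes_map, ← length_flat a, List.take_left,
      List.drop_left, iha, ihb]

theorem flat_fill (s : BinaryTree Unit) (l : List α) (h : l.length = s.numNodes) :
    flat (fill s l) = l := by
  induction s generalizing l with
  | nil => exact (List.length_eq_zero_iff.1 h).symm
  | node _ a b iha ihb =>
    cases l with
    | nil => simp [BinaryTree.numNodes] at h
    | cons x l =>
      simp only [BinaryTree.numNodes, List.length_cons] at h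
      rw [fill, flat, iha _ (by simp; omega), ihb _ (by simp; omega), List.take_append_drop]

theorem shape_fill (s : BinaryTree Unit) (l : List α) (h : l.length = s.numNodes) :
    ((fill s l).map fun _ => ()) = s := by
  induction s generalizing l with
  | nil => rfl
  | node _ a b iha ihb =>
    cases l with
    | nil => simp [BinaryTree.numNodes] at h
    | cons x l =>
      simp only [BinaryTree.numNodes, List.length_cons] at h
      rw [fill, BinaryTree.map, iha _ (by simp; omega), ihb _ (by simp; omega)]

theorem map_fill (f : α → β) (s : BinaryTree Unit) (l : List α) :
    (fill s l).map f = fill s (l.map f) := by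
  induction s generalizing l with
  | nil => rfl
  | node _ a b iha ihb =>
    cases l with
    | nil => rfl
    | cons x l => simp only [fill, BinaryTree.map, iha, ihb, List.map_cons, List.map_take,
        List.map_drop]

theorem labels_eq_map_flat {V : Type} (t : BinaryTree (V × Bool)) :
    labels t = (flat t).map Prod.fst := by
  induction t with
  | nil => rfl
  | node x a b iha ihb => simp [labels, flat, iha, ihb]

/-- The trees with `n` nodes and labels in `α`. -/
def trees (α : Type*) [Fintype α] (n : ℕ) : Finset (BinaryTree α) :=
  (BinaryTree.treesOfNumNodesEq n ×ˢ (Finset.univ : Finset (Fin n → α))).image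
    fun x => fill x.1 (List.ofFn x.2)

theorem mem_trees [Fintype α] {n : ℕ} {t : BinaryTree α} : t ∈ trees α n ↔ t.numNodes = n := by
  simp only [trees, Finset.mem_image, Finset.mem_product, BinaryTree.mem_treesOfNumNodesEq,
    Finset.mem_univ, and_true, Prod.exists]
  constructor
  · rintro ⟨s, l, rfl, rfl⟩
    rw [← length_flat, flat_fill _ _ (by simp), List.length_ofFn]
  · intro h
    refine ⟨t.map fun _ => (), fun i => (flat t).get (i.cast (by rw [length_flat, h])), ?_, ?_⟩
    · rw [numNodes_map, h]
    · have : List.ofFn (fun i : Fin n => (flat t).get (i.cast (by rw [length_flat, h]))) = flat t := by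
        apply List.ext_get
        · simp [length_flat, h]
        · intro k h1 h2; simp
      rw [this, fill_flat]

theorem sum_trees [Fintype α] (n : ℕ) (f : BinaryTree α → ℝ) :
    ∑ t ∈ trees α n, f t = ∑ s ∈ BinaryTree.treesOfNumNodesEq n, ∑ l : Fin n → α,
      f (fill s (List.ofFn l)) := by
  rw [trees, Finset.sum_image, Finset.sum_product]
  rintro ⟨s, l⟩ h ⟨s', l'⟩ h' he
  simp only [Finset.coe_product, Set.mem_prod, Finset.mem_coe,
    BinaryTree.mem_treesOfNumNodesEq] at h h' he
  have e1 := congrArg (BinaryTree.map fun _ => ()) he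
  have e2 := congrArg flat he
  rw [shape_fill _ _ (by simp [h.1]), shape_fill _ _ (by simp [h'.1])] at e1
  rw [flat_fill _ _ (by simp [h.1]), flat_fill _ _ (by simp [h'.1])] at e2
  rw [e1, List.ofFn_injective e2]

theorem sum_trees_zero [Fintype α] (f : BinaryTree α → ℝ) : ∑ t ∈ trees α 0, f t = f .nil := by
  have : trees α 0 = {.nil} := by
    ext t
    rw [mem_trees, Finset.mem_singleton]
    cases t <;> simp [BinaryTree.numNodes]
  rw [this, Finset.sum_singleton]

theorem sum_trees_succ [Fintype α] (n : ℕ) (f : BinaryTree α → ℝ) :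
    ∑ t ∈ trees α (n + 1), f t = ∑ kl ∈ Finset.HasAntidiagonal.antidiagonal n, ∑ a ∈ trees α kl.1,
      ∑ b ∈ trees α kl.2, ∑ j, f (.node j a b) := by
  rw [← Finset.sum_fiberwise_of_maps_to (s := trees α (n + 1))
    (g := fun t => (t.left.numNodes, t.right.numNodes)) (t := Finset.HasAntidiagonal.antidiagonal n)]
  · refine Finset.sum_congr rfl fun kl hkl => ?_
    simp only [← Finset.sum_product']
    symm
    refine Finset.sum_bij (fun x _ => .node x.2.2 x.1 x.2.1) ?_ ?_ ?_ ?_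
    · rintro ⟨a, b, j⟩ h
      simp only [Finset.mem_product, mem_trees, Finset.mem_univ, and_true] at h
      rw [Finset.HasAntidiagonal.mem_antidiagonal] at hkl
      refine Finset.mem_filter.2 ⟨mem_trees.2 ?_, Prod.ext h.1 h.2⟩
      simp only [BinaryTree.numNodes, h.1, h.2, hkl]
    · rintro ⟨a, b, j⟩ _ ⟨a', b', j'⟩ _ he
      simp only [BinaryTree.node.injEq] at he
      simp [he]
    · intro t ht
      simp only [Finset.mem_filter, mem_trees] at ht
      cases t with
      | nil => simp [BinaryTree.numNodes] at ht
      | node j a b =>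
        refine ⟨(a, b, j), ?_, rfl⟩
        simp only [Finset.mem_product, mem_trees, Finset.mem_univ, and_true]
        simp only [BinaryTree.left, BinaryTree.right] at ht
        rw [← ht.2]
        exact ⟨rfl, rfl⟩
    · intros; rfl
  · intro t ht
    rw [mem_trees] at ht
    cases t with
    | nil => simp [BinaryTree.numNodes] at ht
    | node j a b =>
      simpa [BinaryTree.numNodes, BinaryTree.left, BinaryTree.right] using ht

end Trees

/-- The trees of corners hanging from the corner opposite to a leaf `y`, in which every vertex other
than that of `y` occurs exactly once. -/
def leafTrees (n : ℕ) : Finset ((Fin (n + 1) × Bool) × BinaryTree (Fin (n + 1) × Bool)) :=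
  (Finset.univ ×ˢ trees _ n).filter fun x => Proper x.2 (opp x.1)

theorem card_labellings (n : ℕ) :
    (Finset.univ.filter fun l : Fin n → Fin n × Bool =>
      Function.Injective fun k => (l k).1).card = n.factorial * 2 ^ n := by
  have h : (Finset.univ.filter fun l : Fin n → Fin n × Bool =>
      Function.Injective fun k => (l k).1).card =
      ((Finset.univ.filter fun l : Fin n → Fin n => Function.Injective l) ×ˢ
        (Finset.univ : Finset (Fin n → Bool))).card := by
    refine Finset.card_bij (fun l _ => (fun k => (l k).1, fun k => (l k).2)) ?_ ?_ ?_
    · intro l hl; simpa using hl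
    · intro l _ l' _ he
      ext1 k
      exact Prod.ext (congrFun (congrArg Prod.fst he) k) (congrFun (congrArg Prod.snd he) k)
    · rintro ⟨l, b⟩ hl
      exact ⟨fun k => (l k, b k), by simpa using hl, rfl⟩
  rw [h, Finset.card_product, Finset.card_univ, Fintype.card_fun, Fintype.card_bool,
    Fintype.card_fin]
  congr 1
  rw [← Fintype.card_subtype, Fintype.card_congr (Equiv.subtypeInjectiveEquivEmbedding _ _),
    Fintype.card_embedding_eq, Fintype.card_fin, Nat.descFactorial_self]

/-- For a fixed shape, reading the corners in prefix order gives a bijective labelling by vertices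
and a choice of corner at each. Transporting the colouring along this bijection makes all labellings
contribute equally. -/
theorem sum_leafTrees {d : ℕ} (n : ℕ) (W : Fin d → BinaryTree (Fin d) → ℝ) :
    ∑ c : Fin (n + 1) → Fin d, ∑ x ∈ leafTrees n, W (c x.1.1) (x.2.map fun y => c y.1) =
      ((n + 1).factorial * 2 ^ (n + 1) : ℕ) * ∑ j, ∑ u ∈ trees (Fin d) n, W j u := by
  have key : ∀ {α : Type} [Fintype α] (g : α → BinaryTree α → ℝ),
      ∑ j, ∑ u ∈ trees α n, g j u = ∑ s ∈ BinaryTree.treesOfNumNodesEq n,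
        ∑ l : Fin (n + 1) → α, g (l 0) (fill s (List.ofFn fun k => l k.succ)) := by
    intro α _ g
    simp only [sum_trees]
    rw [Finset.sum_comm]
    refine Finset.sum_congr rfl fun s _ => ?_
    rw [← Fintype.sum_prod_type']
    exact (Fintype.sum_equiv (Fin.consEquiv fun _ => α) _ _ fun x => by simp [Fin.consEquiv])
  have hL : ∀ c : Fin (n + 1) → Fin d,
      ∑ x ∈ leafTrees n, W (c x.1.1) (x.2.map fun y => c y.1) =
      ∑ s ∈ BinaryTree.treesOfNumNodesEq n,
        ∑ l : Fin (n + 1) → Fin (n + 1) × Bool with Function.Injective fun k => (l k).1,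
          W (c (l 0).1) (fill s (List.ofFn fun k => c (l k.succ).1)) := by
    intro c
    rw [leafTrees, Finset.sum_filter, Finset.sum_product,
      key fun y a => if Proper a (opp y) then W (c y.1) (a.map fun y => c y.1) else 0]
    refine Finset.sum_congr rfl fun s hs => ?_
    rw [Finset.sum_filter]
    refine Finset.sum_congr rfl fun l _ => ?_
    rw [BinaryTree.mem_treesOfNumNodesEq] at hs
    have hP : Proper (fill s (List.ofFn fun k => l k.succ)) (opp (l 0)) ↔
        Function.Injective fun k => (l k).1 := by
      rw [Proper, labels_eq_map_flat, flat_fill _ _ (by simp [hs]), opp_fst, and_comm,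
        ← List.nodup_cons, ← List.nodup_ofFn, List.ofFn_succ, List.map_ofFn]
      rfl
    simp only [hP, map_fill, List.map_ofFn]
    rfl
  simp only [hL]
  rw [key W, Finset.sum_comm, Finset.mul_sum]
  refine Finset.sum_congr rfl fun s _ => ?_
  rw [Finset.sum_comm, ← card_labellings, ← nsmul_eq_mul, ← Finset.sum_const]
  refine Finset.sum_congr rfl fun l hl => ?_
  have hl' := (Finset.mem_filter.1 hl).2
  set e : Equiv.Perm (Fin (n + 1)) := Equiv.ofBijective _ (Finite.injective_iff_bijective.1 hl')
  exact Fintype.sum_equiv (Equiv.arrowCongr e.symm (Equiv.refl _)) _ _ fun c => rfl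

end

section

variable {V : Type}

/-! ### Enumeration of the one-particle irreducible melonic graphs -/

/-- The graph obtained by cutting the fixed lines `ℓ k` of the vacuum graph `τ`. -/
def cutLeaves [Finite V] {N : ℕ} (τ : Equiv.Perm (V × Bool)) (ℓ : Fin N ↪ V × Bool)
    (π : Equiv.Perm (Fin N)) (hk : ∀ k, τ (ℓ k) = ℓ k) : Wick V N :=
  Equiv.ofBijective (Sum.elim
      (fun x => if h : ∃ k, x = ℓ k then Sum.inr h.choose else Sum.inl (τ x))
      fun k => Sum.inl (ℓ (π.symm k))) <| by
    have h0 : ∀ k (h : ∃ k', ℓ k = ℓ k'), h.choose = k := fun k h =>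
      ℓ.injective h.choose_spec.symm
    refine Finite.injective_iff_bijective.1 ?_
    rintro (x | k) (x' | k') he
    · simp only [Sum.elim_inl] at he
      split_ifs at he with h h' h'
      · rw [h.choose_spec, h'.choose_spec, Sum.inr_injective he]
      · rw [τ.injective (Sum.inl_injective he)]
    · simp only [Sum.elim_inl, Sum.elim_inr] at he
      split_ifs at he with h
      exact absurd ⟨_, τ.injective ((Sum.inl_injective he).trans (hk _).symm)⟩ h
    · simp only [Sum.elim_inl, Sum.elim_inr] at he
      split_ifs at he with h
      exact absurd ⟨_, τ.injective ((Sum.inl_injective he).symm.trans (hk _).symm)⟩ h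
    · simp only [Sum.elim_inr] at he
      rw [π.symm.injective (ℓ.injective (Sum.inl_injective he))]

section CutLeaves

variable [Finite V] {N : ℕ} {τ : Equiv.Perm (V × Bool)} {ℓ : Fin N ↪ V × Bool}
  {π : Equiv.Perm (Fin N)} (hk : ∀ k, τ (ℓ k) = ℓ k)

theorem cutLeaves_uncut {x : V × Bool} (hx : ∀ k, x ≠ ℓ k) :
    cutLeaves τ ℓ π hk (Sum.inl x) = Sum.inl (τ x) := by
  have : ¬ ∃ k, x = ℓ k := by push Not; exact hx
  simp [cutLeaves, this]

theorem cutLeaves_cut (k : Fin N) : cutLeaves τ ℓ π hk (Sum.inl (ℓ k)) = Sum.inr k := by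
  have h : ∃ k', ℓ k = ℓ k' := ⟨k, rfl⟩
  have : h.choose = k := ℓ.injective h.choose_spec.symm
  simp only [cutLeaves, Equiv.ofBijective_apply, Sum.elim_inl, dif_pos h, this]

theorem cutLeaves_inr (k : Fin N) :
    cutLeaves τ ℓ π hk (Sum.inr k) = Sum.inl (ℓ (π.symm k)) := by
  simp [cutLeaves]

theorem isCut_cutLeaves : IsCut τ ℓ (cutLeaves τ ℓ π hk) :=
  ⟨π, fun _ => cutLeaves_uncut hk, fun k => ⟨cutLeaves_cut hk k, by
    rw [cutLeaves_inr, Equiv.symm_apply_apply, hk]⟩⟩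

theorem IsCut.exists_eq_cutLeaves {σ : Wick V N} (h : IsCut τ ℓ σ) :
    ∃ π, σ = cutLeaves τ ℓ π hk := by
  obtain ⟨π, h1, h2⟩ := h
  refine ⟨π, ?_⟩
  ext1 x
  rcases x with x | k
  · by_cases hx : ∀ k, x ≠ ℓ k
    · rw [h1 x hx, cutLeaves_uncut hk hx]
    · push Not at hx
      obtain ⟨k, rfl⟩ := hx
      rw [(h2 k).1, cutLeaves_cut]
  · obtain ⟨k, rfl⟩ := π.surjective k
    rw [(h2 k).2, cutLeaves_inr, Equiv.symm_apply_apply, hk]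

/-- The data of the cut are recovered from the graph, so no symmetry factors arise in the
enumeration. -/
theorem cutLeaves_injective {τ' : Equiv.Perm (V × Bool)} {ℓ' : Fin N ↪ V × Bool}
    {π' : Equiv.Perm (Fin N)} (hk' : ∀ k, τ' (ℓ' k) = ℓ' k)
    (he : cutLeaves τ ℓ π hk = cutLeaves τ' ℓ' π' hk') : τ = τ' ∧ ℓ = ℓ' ∧ π = π' := by
  have hℓ : ℓ = ℓ' := by
    ext1 k
    have h1 := cutLeaves_cut (π := π) hk k
    rw [he, ← cutLeaves_cut (π := π') hk' k] at h1
    exact Sum.inl_injective ((cutLeaves τ' ℓ' π' hk').injective h1)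
  subst hℓ
  refine ⟨?_, rfl, ?_⟩
  · ext1 x
    by_cases hx : ∀ k, x ≠ ℓ k
    · have h1 := cutLeaves_uncut (π := π) hk hx
      rw [he, cutLeaves_uncut hk' hx] at h1
      exact (Sum.inl_injective h1).symm
    · push Not at hx
      obtain ⟨k, rfl⟩ := hx
      rw [hk, hk']
  · have h1 : π.symm = π'.symm := by
      ext1 k
      have h1 := cutLeaves_inr (π := π) hk k
      rw [he, cutLeaves_inr] at h1
      exact (ℓ.injective (Sum.inl_injective h1)).symm
    rw [← Equiv.symm_symm π, h1, Equiv.symm_symm]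

end CutLeaves

/-- Irreducibility makes the cut lines leaves, for which the cut is explicit. -/
theorem isOnePI_and_isMelonic_iff [Fintype V] [Nonempty V] {d N : ℕ} {i : Fin d} {c : V → Fin d}
    {σ : Wick V N} : IsOnePI σ ∧ IsMelonic i c σ ↔
      ∃ (τ : Equiv.Perm (V × Bool)) (ℓ : Fin N ↪ V × Bool) (π : Equiv.Perm (Fin N))
        (hk : ∀ k, τ (ℓ k) = ℓ k), IsVacuumTree τ ∧ σ = cutLeaves τ ℓ π hk ∧
          ∀ k l, (facePerm c τ i).SameCycle (ℓ k) (ℓ l) := by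
  constructor
  · rintro ⟨h1, τ, ℓ, hτ, hc, hf⟩
    rw [isMelonicVacuum_iff] at hτ
    have hk := (hc.isOnePI_iff hτ).1 h1
    obtain ⟨π, hπ⟩ := hc.exists_eq_cutLeaves hk
    exact ⟨τ, ℓ, π, hk, hτ, hπ, hf⟩
  · rintro ⟨τ, ℓ, π, hk, hτ, rfl, hf⟩
    exact ⟨((isCut_cutLeaves hk).isOnePI_iff hτ).2 hk, τ, ℓ, (isMelonicVacuum_iff τ).2 hτ,
      isCut_cutLeaves hk, hf⟩

theorem not_isOnePI_of_isEmpty [IsEmpty V] {N : ℕ} (σ : Wick V N) : ¬ IsOnePI σ := fun h =>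
  not_isEmpty_of_nonempty (h := h.1.nonempty) V inferInstance

theorem Proper.card_labels {t : BinaryTree (V × Bool)} {r : V × Bool} (h : Proper t r) :
    (labels t).toFinset.card = t.numNodes := by
  rw [List.toFinset_card_of_nodup h.1, labels_eq_map_flat, List.length_map, length_flat]

/-! ### Two-point and four-point graphs as leaf trees. -/

section LeafTrees

variable {n : ℕ}

theorem mem_leafTrees {y : Fin (n + 1) × Bool} {a : BinaryTree (Fin (n + 1) × Bool)} :
    (y, a) ∈ leafTrees n ↔ a.numNodes = n ∧ Proper a (opp y) := by
  simp [leafTrees, mem_trees]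

theorem mem_labels_of_mem_leafTrees {y : Fin (n + 1) × Bool}
    {a : BinaryTree (Fin (n + 1) × Bool)} (h : (y, a) ∈ leafTrees n) (v : Fin (n + 1)) :
    v ∈ labels a ↔ v ≠ y.1 := by
  rw [mem_leafTrees] at h
  obtain ⟨h1, h2, h3⟩ := h
  rw [opp_fst] at h3
  constructor
  · rintro hv rfl; exact h3 hv
  · intro hv
    have h4 : (y.1 :: labels a).Nodup := List.nodup_cons.2 ⟨h3, h2⟩
    have h5 : (y.1 :: labels a).toFinset = Finset.univ := by
      apply Finset.eq_univ_of_card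
      rw [List.toFinset_card_of_nodup h4, List.length_cons, labels_eq_map_flat, List.length_map,
        length_flat, h1, Fintype.card_fin]
    have h6 : v ∈ (y.1 :: labels a).toFinset := by rw [h5]; exact Finset.mem_univ v
    simpa [hv] using h6

theorem treePerm_leaf {y : V × Bool} {a : BinaryTree (V × Bool)} (h : Proper a (opp y)) :
    treePerm a (opp y) y = y := by
  refine treePerm_of_not_inDom _ _ _ ?_
  rintro (h1 | h1)
  · exact opp_ne y h1.symm
  · exact h.2 h1

theorem isVacuumTree_of_mem_leafTrees {y : Fin (n + 1) × Bool}
    {a : BinaryTree (Fin (n + 1) × Bool)} (h : (y, a) ∈ leafTrees n) :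
    IsVacuumTree (treePerm a (opp y)) := by
  have hp := (mem_leafTrees.1 h).2
  rw [isVacuumTree_iff_of_leaf (treePerm_leaf hp)]
  convert isRootedTree_treePerm hp
  ext v
  simp [mem_labels_of_mem_leafTrees h]

theorem IsVacuumTree.exists_mem_leafTrees {τ : Equiv.Perm (Fin (n + 1) × Bool)}
    (h : IsVacuumTree τ) {y : Fin (n + 1) × Bool} (hy : τ y = y) :
    ∃ a, (y, a) ∈ leafTrees n ∧ treePerm a (opp y) = τ := by
  rw [isVacuumTree_iff_of_leaf hy] at h
  obtain ⟨a, h1, h2, h3⟩ := exists_treePerm_eq _ _ rfl (opp y) (by simp) τ h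
  refine ⟨a, mem_leafTrees.2 ⟨?_, h1⟩, h3⟩
  have := h1.card_labels.symm.trans (congrArg Finset.card h2)
  simpa using this

theorem treePerm_injOn_leafTrees {y : Fin (n + 1) × Bool}
    {a a' : BinaryTree (Fin (n + 1) × Bool)} (h : (y, a) ∈ leafTrees n)
    (h' : (y, a') ∈ leafTrees n) (he : treePerm a (opp y) = treePerm a' (opp y)) : a = a' :=
  treePerm_injective (mem_leafTrees.1 h).2 (mem_leafTrees.1 h').2 (fun v => by
    rw [mem_labels_of_mem_leafTrees h, mem_labels_of_mem_leafTrees h']) he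

variable {d : ℕ} {η m Λ : ℝ} {K : Finset (Momentum d)}

/-- Graphs correspond bijectively to a cut leaf with the tree hanging from its opposite corner. -/
theorem sum_twoPoint (hK : ∀ q, propagator η m Λ q ≠ 0 → q ∈ K) (c : Fin (n + 1) → Fin d)
    (p : Momentum d) :
    (∑ σ : Wick (Fin (n + 1)) 1, if IsOnePI σ ∧ ∃ i, IsMelonic i c σ then
      amplitude η m Λ c σ (fun _ => p) (fun _ => p) else 0) =
      ∑ x ∈ leafTrees n, ∑ k ∈ K with k (c x.1.1) = p (c x.1.1),
        colorAmplitude K (propagator η m Λ) (x.2.map fun y => c y.1) k := by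
  rw [← Finset.sum_filter]
  symm
  have hleaf : ∀ x ∈ leafTrees n, ∀ k : Fin 1, treePerm x.2 (opp x.1)
      ((⟨fun _ => x.1, fun _ _ _ => Subsingleton.elim _ _⟩ : Fin 1 ↪ _) k) =
      (⟨fun _ => x.1, fun _ _ _ => Subsingleton.elim _ _⟩ : Fin 1 ↪ _) k := fun x hx _ =>
    treePerm_leaf (mem_leafTrees.1 hx).2
  refine Finset.sum_bij (fun x hx => cutLeaves (treePerm x.2 (opp x.1))
    ⟨fun _ => x.1, fun _ _ _ => Subsingleton.elim _ _⟩ 1 (hleaf x hx)) ?_ ?_ ?_ ?_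
  · rintro x hx
    -- A single cut line satisfies the face condition for every colour, so any colour may be chosen.
    have := isOnePI_and_isMelonic_iff (i := c 0) (c := c).2 ⟨_, _, 1, hleaf x hx,
      isVacuumTree_of_mem_leafTrees hx, rfl, fun k l => Equiv.Perm.SameCycle.refl _ _⟩
    exact Finset.mem_filter.2 ⟨Finset.mem_univ _, this.1, _, this.2⟩
  · rintro ⟨y, a⟩ hx ⟨y', a'⟩ hx' he
    obtain ⟨h1, h2, -⟩ := cutLeaves_injective _ _ he
    have : y = y' := congrFun (congrArg (fun e : Fin 1 ↪ _ => (e : Fin 1 → _)) h2) 0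
    subst this
    rw [treePerm_injOn_leafTrees hx hx' h1]
  · intro σ hσ
    obtain ⟨h1, i, h2⟩ := (Finset.mem_filter.1 hσ).2
    obtain ⟨τ, ℓ, π, hk, hτ, rfl, -⟩ := isOnePI_and_isMelonic_iff.1 ⟨h1, h2⟩
    obtain ⟨a, ha, rfl⟩ := hτ.exists_mem_leafTrees (hk 0)
    refine ⟨(ℓ 0, a), ha, ?_⟩
    have e1 : (⟨fun _ => ℓ 0, fun _ _ _ => Subsingleton.elim _ _⟩ : Fin 1 ↪ _) = ℓ := by
      ext1 k; rw [Subsingleton.elim k 0]; rfl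
    have e2 : (1 : Equiv.Perm (Fin 1)) = π := Subsingleton.elim _ _
    simp only [e1, e2]
  · rintro ⟨y, a⟩ hx
    have hp := (mem_leafTrees.1 hx).2
    rw [(isCut_cutLeaves (hleaf _ hx)).amplitude_eq (isVacuumTree_of_mem_leafTrees hx)
      (hleaf _ hx) 0 hp (mem_labels_of_mem_leafTrees hx) rfl hK
      (Or.inr fun k => Subsingleton.elim _ _)]
    refine Finset.sum_congr rfl fun k _ => ?_
    rw [← treeAmplitude_const c K _ a (opp y)]
    refine (congrFun (treeAmplitude_congr fun z hz => ?_) k).symm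
    have : z ≠ y := by
      rintro rfl
      rcases hz with h1 | h1
      · exact opp_ne z h1.symm
      · exact hp.2 h1
    ext1 q
    exact if_pos fun _ => this

/-- Two distinct lines, as an embedding. -/
def pairEmbedding {α : Type*} (x y : α) (h : y ≠ x) : Fin 2 ↪ α :=
  ⟨![x, y], by
    intro k l hkl
    fin_cases k <;> fin_cases l <;> simp_all [eq_comm]⟩

/-- The first cut leaf is the attachment point and the second a leaf on its colour-`i` face. Their
order is fixed by the labels of the external `T̄`, and the factor `2` counts the labellings `π` of
the external `T`. -/
theorem sum_fourPoint (hK : ∀ q, propagator η m Λ q ≠ 0 → q ∈ K) (c : Fin (n + 1) → Fin d)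
    (i : Fin d) {p : Momentum d} (hp : p ∈ K) :
    (∑ σ : Wick (Fin (n + 1)) 2, if IsOnePI σ ∧ IsMelonic i c σ then
      amplitude η m Λ c σ (fun _ => p) (fun _ => p) else 0) =
      2 * ∑ x ∈ leafTrees n, if c x.1.1 = i then ∑ k ∈ K with k i = p i,
        (markedAmplitude K (propagator η m Λ) i p (x.2.map fun y => c y.1) k +
          cutRoot p (x.2.map fun y => c y.1) k) else 0 := by
  rw [← Finset.sum_filter]
  set D := (((leafTrees n).filter fun x => c x.1.1 = i).sigma
    fun x => faceLeaves c i x.2 (opp x.1)) with hD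
  have memD : ∀ {y a z}, (⟨(y, a), z⟩ : Σ _ : _ × _, _) ∈ D ↔
      (y, a) ∈ leafTrees n ∧ c y.1 = i ∧ z ∈ faceLeaves c i a (opp y) := by
    intro y a z
    simp only [hD, Finset.mem_sigma, Finset.mem_filter, and_assoc]
  have hne : ∀ {y a z}, (⟨(y, a), z⟩ : Σ _ : _ × _, _) ∈ D → z ≠ y := by
    intro y a z h
    obtain ⟨h1, -, h2⟩ := memD.1 h
    have hp := (mem_leafTrees.1 h1).2
    rintro rfl
    rcases inDom_of_mem_faceLines ((mem_faceLeaves hp).1 h2).1 with h3 | h3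
    · exact opp_ne z h3.symm
    · exact hp.2 h3
  have hleaf : ∀ {y a z} (h : (⟨(y, a), z⟩ : Σ _ : _ × _, _) ∈ D), ∀ k,
      treePerm a (opp y) (pairEmbedding y z (hne h) k) = pairEmbedding y z (hne h) k := by
    intro y a z h
    obtain ⟨h1, -, h2⟩ := memD.1 h
    have hp := (mem_leafTrees.1 h1).2
    rw [Fin.forall_fin_two]
    exact ⟨treePerm_leaf hp, ((mem_faceLeaves hp).1 h2).2⟩
  have hsum : ∑ x ∈ D ×ˢ (Finset.univ : Finset (Equiv.Perm (Fin 2))),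
      ∑ k ∈ K with k (c x.1.1.1.1) = p (c x.1.1.1.1), treeAmplitude c K
        (markWeight (propagator η m Λ) p x.1.2) x.1.1.2 (opp x.1.1.1) k =
      2 * ∑ x ∈ leafTrees n, if c x.1.1 = i then ∑ k ∈ K with k i = p i,
        (markedAmplitude K (propagator η m Λ) i p (x.2.map fun y => c y.1) k +
          cutRoot p (x.2.map fun y => c y.1) k) else 0 := by
    rw [Finset.sum_product_right]
    simp only [Finset.sum_const]
    rw [Finset.card_univ, Fintype.card_perm,
      Fintype.card_fin, nsmul_eq_mul, hD, Finset.sum_sigma, ← Finset.sum_filter]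
    norm_num
    refine Finset.sum_congr rfl fun x hx => ?_
    obtain ⟨h1, h2⟩ := Finset.mem_filter.1 hx
    rw [Finset.sum_comm, h2]
    exact Finset.sum_congr rfl fun k _ => sum_faceLeaves (mem_leafTrees.1 h1).2 k
  rw [← hsum]
  symm
  refine Finset.sum_bij (fun x hx => cutLeaves (treePerm x.1.1.2 (opp x.1.1.1))
    (pairEmbedding x.1.1.1 x.1.2 (hne (Finset.mem_product.1 hx).1)) x.2
    (hleaf (Finset.mem_product.1 hx).1)) ?_ ?_ ?_ ?_
  · rintro ⟨⟨⟨y, a⟩, z⟩, π⟩ hx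
    have hx := (Finset.mem_product.1 hx).1
    obtain ⟨h1, h2, h3⟩ := memD.1 hx
    have hs := ((sameCycle_facePerm_iff (mem_leafTrees.1 h1).2 rfl (hne hx)).2 ⟨h2, h3⟩).1
    refine Finset.mem_filter.2 ⟨Finset.mem_univ _, isOnePI_and_isMelonic_iff.2 ⟨_, _, _, hleaf hx,
      isVacuumTree_of_mem_leafTrees h1, rfl, ?_⟩⟩
    simp only [Fin.forall_fin_two]
    exact ⟨⟨Equiv.Perm.SameCycle.refl _ _, hs⟩, ⟨hs.symm, Equiv.Perm.SameCycle.refl _ _⟩⟩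
  · rintro ⟨⟨⟨y, a⟩, z⟩, π⟩ hx ⟨⟨⟨y', a'⟩, z'⟩, π'⟩ hx' he
    obtain ⟨h1, h2, h3⟩ := cutLeaves_injective _ _ he
    have e1 : y = y' := congrFun (congrArg (fun e : Fin 2 ↪ _ => (e : Fin 2 → _)) h2) 0
    have e2 : z = z' := congrFun (congrArg (fun e : Fin 2 ↪ _ => (e : Fin 2 → _)) h2) 1
    have e3 : π = π' := h3
    subst e1 e2 e3
    rw [treePerm_injOn_leafTrees (memD.1 (Finset.mem_product.1 hx).1).1
      (memD.1 (Finset.mem_product.1 hx').1).1 h1]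
  · intro σ hσ
    obtain ⟨τ, ℓ, π, hk, hτ, rfl, hf⟩ := isOnePI_and_isMelonic_iff.1 (Finset.mem_filter.1 hσ).2
    obtain ⟨a, ha, rfl⟩ := hτ.exists_mem_leafTrees (hk 0)
    have hne' : ℓ 1 ≠ ℓ 0 := fun e => by simpa using ℓ.injective e
    have hs := (sameCycle_facePerm_iff (mem_leafTrees.1 ha).2 rfl hne').1 ⟨hf 0 1, hk 1⟩
    have hmem : (⟨(ℓ 0, a), ℓ 1⟩ : Σ _ : _ × _, _) ∈ D := memD.2 ⟨ha, hs⟩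
    refine ⟨(⟨(ℓ 0, a), ℓ 1⟩, π), Finset.mem_product.2 ⟨hmem, Finset.mem_univ _⟩, ?_⟩
    have e1 : pairEmbedding (ℓ 0) (ℓ 1) hne' = ℓ := by
      ext1 k
      revert k
      rw [Fin.forall_fin_two]
      exact ⟨rfl, rfl⟩
    simp only [e1]
  · rintro ⟨⟨⟨y, a⟩, z⟩, π⟩ hx
    have hx := (Finset.mem_product.1 hx).1
    obtain ⟨h1, h2, h3⟩ := memD.1 hx
    have hpr := (mem_leafTrees.1 h1).2
    rw [(isCut_cutLeaves (hleaf hx)).amplitude_eq (isVacuumTree_of_mem_leafTrees h1)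
      (hleaf hx) 0 hpr (mem_labels_of_mem_leafTrees h1) rfl hK (Or.inl hp)]
    refine Finset.sum_congr rfl fun k _ => ?_
    refine congrFun (treeAmplitude_congr fun w hw => ?_) k
    have hwy : w ≠ y := by
      rintro rfl
      rcases hw with h4 | h4
      · exact opp_ne w h4.symm
      · exact hpr.2 h4
    ext1 q
    have : (∀ k, w ≠ pairEmbedding y z (hne hx) k) ↔ w ≠ z := by
      rw [Fin.forall_fin_two]
      exact ⟨fun h => h.2, fun h => ⟨hwy, h⟩⟩
    rw [cutWeight, markWeight]
    by_cases hwz : w = z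
    · rw [if_neg fun h => this.1 h hwz, if_pos hwz]
    · rw [if_pos (this.2 hwz), if_neg hwz]

end LeafTrees

end

section

variable {d : ℕ}

/-! ### Generating functions -/

/-- The generating function of the trees of colours with weight `F`. -/
def treeSeries (F : BinaryTree (Fin d) → ℝ) : PowerSeries ℝ :=
  PowerSeries.mk fun n => (-2) ^ n * ∑ u ∈ trees (Fin d) n, F u

theorem treeSeries_sum {ι : Type*} (s : Finset ι) (F : ι → BinaryTree (Fin d) → ℝ) :
    treeSeries (fun u => ∑ k ∈ s, F k u) = ∑ k ∈ s, treeSeries (F k) := by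
  ext n
  simp only [treeSeries, PowerSeries.coeff_mk, map_sum]
  rw [← Finset.mul_sum, Finset.sum_comm]

theorem treeSeries_add (F F' : BinaryTree (Fin d) → ℝ) :
    treeSeries (fun u => F u + F' u) = treeSeries F + treeSeries F' := by
  ext n
  simp only [treeSeries, PowerSeries.coeff_mk, map_add, Finset.sum_add_distrib, mul_add]

theorem treeSeries_mul_left (x : ℝ) (F : BinaryTree (Fin d) → ℝ) :
    treeSeries (fun u => x * F u) = PowerSeries.C x * treeSeries F := by
  ext n
  simp only [treeSeries, PowerSeries.coeff_mk, PowerSeries.coeff_C_mul, ← Finset.mul_sum]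
  ring

/-- Removing the root vertex costs one factor `-2λ` and turns the sum over trees into a product over
the two subtrees. Two products are allowed since a marked leaf may lie in either subtree. -/
theorem treeSeries_eq {F B B' : BinaryTree (Fin d) → ℝ} {A A' : Fin d → BinaryTree (Fin d) → ℝ}
    (h : ∀ j a b, F (.node j a b) = A j a * B b + A' j a * B' b) :
    treeSeries F = PowerSeries.C (F .nil) - 2 * PowerSeries.X *
      ((∑ j, treeSeries (A j)) * treeSeries B + (∑ j, treeSeries (A' j)) * treeSeries B') := by
  have key : ∀ (n : ℕ) (A : Fin d → BinaryTree (Fin d) → ℝ) (B : BinaryTree (Fin d) → ℝ),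
      PowerSeries.coeff n ((∑ j, treeSeries (A j)) * treeSeries B) = (-2) ^ n *
        ∑ kl ∈ Finset.HasAntidiagonal.antidiagonal n, ∑ a ∈ trees (Fin d) kl.1,
          ∑ b ∈ trees (Fin d) kl.2, ∑ j, A j a * B b := by
    intro n A B
    rw [← treeSeries_sum, PowerSeries.coeff_mul, Finset.mul_sum]
    refine Finset.sum_congr rfl fun kl hkl => ?_
    rw [Finset.HasAntidiagonal.mem_antidiagonal] at hkl
    simp only [treeSeries, PowerSeries.coeff_mk]
    rw [mul_mul_mul_comm, ← pow_add, hkl, Finset.sum_mul_sum]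
    simp only [Finset.sum_mul]
  ext n
  rw [mul_comm (2 : PowerSeries ℝ), mul_assoc]
  cases n with
  | zero =>
    rw [map_sub, PowerSeries.coeff_zero_X_mul]
    simp [treeSeries, sum_trees_zero]
  | succ n =>
    have h2 : (2 : PowerSeries ℝ) = PowerSeries.C 2 := (map_ofNat _ 2).symm
    rw [map_sub, PowerSeries.coeff_succ_X_mul, h2, PowerSeries.coeff_C_mul, map_add, key, key,
      treeSeries, PowerSeries.coeff_mk, sum_trees_succ, PowerSeries.coeff_C,
      if_neg (Nat.succ_ne_zero n), pow_succ]
    simp only [h, Finset.sum_add_distrib]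
    ring

section Series

variable (K : Finset (Momentum d)) (C : Momentum d → ℝ)

/-- The melonic connected two-point function. -/
def fullSeries (q : Momentum d) : PowerSeries ℝ := treeSeries fun u => colorAmplitude K C u q

/-- The self-energy in terms of the connected two-point function. -/
def selfSeries (q : Momentum d) : PowerSeries ℝ :=
  -(2 * PowerSeries.X * ∑ j, ∑ k ∈ K with k j = q j, fullSeries K C k)

/-- The connected function with an additional cut leaf on the face of colour `i` of the root. -/
def markedSeries (i : Fin d) (p q : Momentum d) : PowerSeries ℝ :=
  treeSeries fun u => markedAmplitude K C i p u q

/-- The one-particle irreducible function with two cut leaves on the same face of colour `i`. -/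
def ladderSeries (i : Fin d) (p q : Momentum d) : PowerSeries ℝ :=
  -(2 * PowerSeries.X *
    ∑ k ∈ K with k i = q i, (markedSeries K C i p k + PowerSeries.C (if k = p then 1 else 0)))

theorem treeSeries_cutRoot (p q : Momentum d) :
    treeSeries (cutRoot p · q) = PowerSeries.C (if q = p then 1 else 0) := by
  rw [treeSeries_eq (A := 0) (B := 0) (A' := 0) (B' := 0) (by simp [cutRoot])]
  have : treeSeries (0 : BinaryTree (Fin d) → ℝ) = 0 := by ext n; simp [treeSeries]
  simp [cutRoot, this]

/-- The Dyson equation: the left branches, summed over the colour of the root vertex, form the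
self-energy. -/
theorem fullSeries_eq (q : Momentum d) :
    fullSeries K C q = PowerSeries.C (C q) * (1 + selfSeries K C q * fullSeries K C q) := by
  have h0 : treeSeries (0 : BinaryTree (Fin d) → ℝ) = 0 := by ext n; simp [treeSeries]
  refine (treeSeries_eq (A := fun j a => C q * ∑ k ∈ K with k j = q j, colorAmplitude K C a k)
    (B := fun b => colorAmplitude K C b q) (A' := 0) (B' := 0)
    (fun j a b => by simp only [colorAmplitude, Pi.zero_apply]; ring)).trans ?_
  simp only [treeSeries_mul_left, treeSeries_sum, Pi.zero_apply, h0, selfSeries, fullSeries,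
    colorAmplitude, ← Finset.mul_sum]
  ring

/-- The marked leaf sits either in the first 1PI insertion, giving `ladderSeries`, or further along
the chain, after an ordinary self-energy. -/
theorem markedSeries_eq (i : Fin d) (p q : Momentum d) :
    markedSeries K C i p q = PowerSeries.C (C q) * (ladderSeries K C i p q * fullSeries K C q +
      selfSeries K C q * markedSeries K C i p q) := by
  refine (treeSeries_eq
    (A := fun j a => C q * if j = i then ∑ k ∈ K with k j = q j,
      (markedAmplitude K C i p a k + cutRoot p a k) else 0)
    (B := fun b => colorAmplitude K C b q)
    (A' := fun j a => C q * ∑ k ∈ K with k j = q j, colorAmplitude K C a k)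
    (B' := fun b => markedAmplitude K C i p b q)
    (fun j a b => by
      simp only [markedAmplitude]
      split_ifs <;> ring)).trans ?_
  have h1 : ∑ j, treeSeries (fun a => C q * if j = i then ∑ k ∈ K with k j = q j,
      (markedAmplitude K C i p a k + cutRoot p a k) else 0) = PowerSeries.C (C q) *
      ∑ k ∈ K with k i = q i,
        (markedSeries K C i p k + PowerSeries.C (if k = p then 1 else 0)) := by
    rw [Finset.sum_eq_single i]
    · simp only [if_true, treeSeries_mul_left, treeSeries_sum, treeSeries_add, treeSeries_cutRoot,
        markedSeries]
    · intro j _ hj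
      ext n
      simp [treeSeries, hj]
    · simp
  rw [h1]
  simp only [treeSeries_mul_left, treeSeries_sum, selfSeries, fullSeries, markedSeries,
    markedAmplitude, ladderSeries, ← Finset.mul_sum, map_zero]
  ring

/-- This is what makes the ladder equation a scalar one. -/
theorem ladderSeries_congr {i : Fin d} {p q q' : Momentum d} (h : q i = q' i) :
    ladderSeries K C i p q = ladderSeries K C i p q' := by
  simp only [ladderSeries, h]

end Series

/-! ### The correlation functions of the model as tree series. -/

section Model

variable {η m Λ : ℝ} {K : Finset (Momentum d)}

/-- The factor `(n + 1)! 2^(n + 1)` of the enumeration cancels the factorial; of the resulting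
`(-2)^(n + 1)`, one factor belongs to the vertex of the cut leaf and the others to `treeSeries`. -/
theorem onePISeries_eq {N : ℕ} {R : (n : ℕ) → (Fin n → Fin d) → Wick (Fin n) N → Prop}
    {r s : Fin N → Momentum d} {x : ℝ} {W : Fin d → BinaryTree (Fin d) → ℝ}
    (h : ∀ n (c : Fin (n + 1) → Fin d),
      (∑ σ, if IsOnePI σ ∧ R (n + 1) c σ then amplitude η m Λ c σ r s else 0) =
        x * ∑ y ∈ leafTrees n, W (c y.1.1) (y.2.map fun y => c y.1)) :
    onePISeries η m Λ R r s =
      -(2 * PowerSeries.X * (PowerSeries.C x * ∑ j, treeSeries (W j))) := by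
  ext n
  rw [mul_comm (2 : PowerSeries ℝ), mul_assoc, map_neg]
  cases n with
  | zero =>
    -- Order zero vanishes because a graph without vertices is not connected.
    rw [PowerSeries.coeff_zero_X_mul, onePISeries, PowerSeries.coeff_mk]
    simp [not_isOnePI_of_isEmpty]
  | succ n =>
    have h2 : (2 : PowerSeries ℝ) = PowerSeries.C 2 := (map_ofNat _ 2).symm
    have h3 : ((n + 1).factorial : ℝ) ≠ 0 := by positivity
    rw [PowerSeries.coeff_succ_X_mul, h2, PowerSeries.coeff_C_mul, PowerSeries.coeff_C_mul,
      ← treeSeries_sum, onePISeries, PowerSeries.coeff_mk, treeSeries, PowerSeries.coeff_mk]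
    simp only [h]
    rw [← Finset.mul_sum, sum_leafTrees, Finset.sum_comm (s := trees (Fin d) n)]
    push_cast
    rw [show (-2 : ℝ) = (-1) * 2 by norm_num, mul_pow]
    field_simp
    ring

theorem selfEnergy_eq (hK : ∀ q, propagator η m Λ q ≠ 0 → q ∈ K) (p : Momentum d) :
    selfEnergy η m Λ p = selfSeries K (propagator η m Λ) p := by
  rw [selfEnergy, onePISeries_eq (x := 1)
    (W := fun j u => ∑ k ∈ K with k j = p j, colorAmplitude K (propagator η m Λ) u k)
    (fun n c => by rw [one_mul]; convert sum_twoPoint hK c p)]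
  simp only [treeSeries_sum, selfSeries, fullSeries, map_one, one_mul]

theorem gamma4_eq (hK : ∀ q, propagator η m Λ q ≠ 0 → q ∈ K) (h0 : (0 : Momentum d) ∈ K)
    (i : Fin d) : gamma4 η m Λ i = -(2 * ladderSeries K (propagator η m Λ) i 0 0) := by
  have h2 : (2 : PowerSeries ℝ) = PowerSeries.C 2 := (map_ofNat _ 2).symm
  rw [gamma4, Gamma4, onePISeries_eq (x := 2)
    (W := fun j u => if j = i then ∑ k ∈ K with k i = (0 : Momentum d) i,
      (markedAmplitude K (propagator η m Λ) i 0 u k + cutRoot 0 u k) else 0)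
    (fun n c => by rw [sum_fourPoint hK c i h0])]
  rw [Finset.sum_eq_single i]
  · simp only [if_true, treeSeries_sum, treeSeries_add, treeSeries_cutRoot, ladderSeries,
      markedSeries, ← h2]
    ring
  · intro j _ hj
    ext n
    simp [treeSeries, hj]
  · simp

theorem kinetic_pos (hm : 0 < m) (q : Momentum d) : 0 < kinetic η m q := by
  have h1 : 0 ≤ momentumPow η q := Finset.sum_nonneg fun i _ => Real.rpow_nonneg (abs_nonneg _) _
  have h2 : 0 < m ^ (2 * η) := Real.rpow_pos_of_pos hm _
  rw [kinetic]
  linarith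

theorem finite_below_cutoff (hη : 0 < η) (hΛ : 0 < Λ) :
    {q : Momentum d | momentumPow η q ≤ Λ ^ (2 * η)}.Finite := by
  refine (Set.finite_Icc (fun _ : Fin d => -⌈Λ⌉) fun _ => ⌈Λ⌉).subset fun q hq => ?_
  have h : ∀ i, |q i| ≤ ⌈Λ⌉ := by
    intro i
    have h1 : |(q i : ℝ)| ^ (2 * η) ≤ Λ ^ (2 * η) :=
      (Finset.single_le_sum (f := fun i => |(q i : ℝ)| ^ (2 * η))
        (fun i _ => Real.rpow_nonneg (abs_nonneg _) _) (Finset.mem_univ i)).trans hq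
    rw [Real.rpow_le_rpow_iff (abs_nonneg _) hΛ.le (by positivity)] at h1
    have h2 : ((|q i| : ℤ) : ℝ) ≤ (⌈Λ⌉ : ℝ) := by
      push_cast
      exact h1.trans (Int.le_ceil Λ)
    exact_mod_cast h2
  exact ⟨fun i => (abs_le.1 (h i)).1, fun i => (abs_le.1 (h i)).2⟩

end Model

end

end Melonic

end

/-! ### Solution of the ladder equation. -/

theorem mainTheorem7 {d : ℕ} (i : Fin d) (η m Λ : ℝ) (hη : 0 < η) (hm : 0 < m) (hΛ : 0 < Λ) :
    Melonic.gamma4 η m Λ i =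
      4 * PowerSeries.X * (1 + 2 * PowerSeries.X * Melonic.loopL η m Λ i)⁻¹ := by
  open Melonic in
  have hfin := finite_below_cutoff (d := d) hη hΛ
  set K := hfin.toFinset with hKdef
  have memK : ∀ q, q ∈ K ↔ momentumPow η q ≤ Λ ^ (2 * η) := fun q => by simp [hKdef]
  have hprop : ∀ q ∈ K, kinetic η m q * propagator η m Λ q = 1 := fun q hq => by
    rw [propagator, heaviside, if_pos (sub_nonneg.2 ((memK q).1 hq))]
    exact mul_one_div_cancel (kinetic_pos hm q).ne'
  have hK : ∀ q, propagator η m Λ q ≠ 0 → q ∈ K := fun q hq => by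
    by_contra hc
    rw [memK, ← sub_nonneg] at hc
    exact hq (by rw [propagator, heaviside, if_neg hc, zero_div])
  have h0 : (0 : Momentum d) ∈ K := by
    rw [memK, momentumPow]
    simp only [Pi.zero_apply, Int.cast_zero, abs_zero,
      Real.zero_rpow (mul_pos two_pos hη).ne', Finset.sum_const_zero]
    exact Real.rpow_nonneg hΛ.le _
  set C : Momentum d → ℝ := propagator η m Λ with hC
  -- The Dyson equation times the kinetic kernel, which inverts the propagator below the cutoff.
  have hG : ∀ q ∈ K, Gamma2 η m Λ q * fullSeries K C q = 1 := fun q hq => by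
    have h1 : PowerSeries.C (kinetic η m q) * PowerSeries.C (C q) = 1 := by
      rw [← map_mul, hprop q hq, map_one]
    have h2 := fullSeries_eq K C q
    rw [Gamma2, selfEnergy_eq hK, ← hC]
    linear_combination PowerSeries.C (kinetic η m q) * h2 +
      (1 + selfSeries K C q * fullSeries K C q) * h1
  -- Resummed by `hG`, the chains of self-energies on the two sides of the 1PI part are two full
  -- propagators.
  have hH : ∀ q ∈ K, markedSeries K C i 0 q =
      fullSeries K C q ^ 2 * ladderSeries K C i 0 q := fun q hq => by
    have h1 : PowerSeries.C (kinetic η m q) * PowerSeries.C (C q) = 1 := by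
      rw [← map_mul, hprop q hq, map_one]
    have h2 := markedSeries_eq K C i 0 q
    have h3 := hG q hq
    rw [Gamma2, selfEnergy_eq hK, ← hC] at h3
    linear_combination -markedSeries K C i 0 q * h3 +
      fullSeries K C q * PowerSeries.C (kinetic η m q) * h2 + fullSeries K C q *
        (ladderSeries K C i 0 q * fullSeries K C q + selfSeries K C q * markedSeries K C i 0 q) * h1
  have hL : loopL η m Λ i = ∑ q ∈ K with q i = (0 : Momentum d) i, fullSeries K C q ^ 2 := by
    have hs : {q : Momentum d | q i = 0 ∧ momentumPow η q ≤ Λ ^ (2 * η)} =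
        ↑(K.filter fun q => q i = (0 : Momentum d) i) := by
      ext q
      simp [memK, and_comm]
    rw [loopL, hs, finsum_mem_coe_finset]
    refine Finset.sum_congr rfl fun q hq => ?_
    have h1 := hG q (Finset.mem_filter.1 hq).1
    have h2 : PowerSeries.constantCoeff (Gamma2 η m Λ q) ≠ 0 := fun h => by
      have := congrArg PowerSeries.constantCoeff h1
      simp [h] at this
    rw [← (PowerSeries.eq_inv_iff_mul_eq_one h2).2 (by rw [mul_comm]; exact h1)]
  have hΦ : ladderSeries K C i 0 0 * (1 + 2 * PowerSeries.X * loopL η m Λ i) =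
      -(2 * PowerSeries.X) := by
    -- All momenta in the sum have `q i = 0`, so the 1PI function factors out and leaves `𝓛`; the
    -- Kronecker delta contributes `1` because `0 ∈ K`.
    have h1 : ladderSeries K C i 0 0 = -(2 * PowerSeries.X *
        (loopL η m Λ i * ladderSeries K C i 0 0 + 1)) := by
      conv_lhs => rw [ladderSeries]
      congr 2
      rw [Finset.sum_add_distrib, hL, Finset.sum_mul]
      congr 1
      · refine Finset.sum_congr rfl fun q hq => ?_
        obtain ⟨h2, h3⟩ := Finset.mem_filter.1 hq
        rw [hH q h2, ladderSeries_congr K C h3]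
      · rw [Finset.sum_eq_single 0]
        · simp
        · intro q _ hq; simp [hq]
        · simp [h0]
    linear_combination h1
  rw [PowerSeries.eq_mul_inv_iff_mul_eq (by simp), gamma4_eq hK h0]
  linear_combination -2 * hΦ
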